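/- **Conventions.** All tensor products of C\*-algebras are spatial (minimal). Let $\mathcal{A}$ be a unital C\*-algebra. A representation $\pi:\mathcal{A}\to\mathbf{L}(\mathcal{H})$ on a Hilbert space is called *atomic* if it is the Hilbert space direct sum of a family of pairwise inequivalent irreducible representations. Let $\pi$ be a faithful atomic representation, regard $\mathcal{A}$ as a subalgebra of $\mathbf{L}(\mathcal{H})$ and $\mathcal{A}\otimes\mathcal{A}$ as a subalgebra of $\mathbf{L}(\mathcal{H}\bar\otimes\mathcal{H})$, and let $\mathcal{A}''=\pi(\mathcal{A})''$. Let $P_\delta$ be the supremum of all projections $p\otimes p$ with $p$ a minimal projection of $\mathcal{A}''$, and let $\mathcal{H}_\delta\subseteq\mathcal{H}\bar\otimes\mathcal{H}$ be its range. A *quantum metric* with respect to $\pi$ is an element $\rho\in\mathcal{A}\otimes\mathcal{A}$ such that 1. $\rho\ge 0$; 2. $\rho P_\delta=P_\delta\rho=0$; 3. $0$ is not an eigenvalue of the restriction of $\rho$ to $\mathcal{H}_\delta^\perp$; 4. $\mathfrak{F}(\rho)=\rho$, where $\mathfrak{F}$ is the flip $a\otimes b\mapsto b\otimes a$; 5.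 $\mathfrak{M}(\rho)\le\rho\otimes 1+1\otimes\rho$ in $\mathcal{A}\otimes\mathcal{A}\otimes\mathcal{A}$, where $\mathfrak{M}$ is the \*-morphism $a\otimes b\mapsto a\otimes 1\otimes b$. In this case $(\mathcal{A},\rho,\pi)$ is called a *compact quantum metric space*. **Theorem.** Let $(\mathcal{A}_1,\rho_1,\pi_1)$ and $(\mathcal{A}_2,\rho_2,\pi_2)$ be compact quantum metric spaces and let $r>0$ be a real number with $r\ge\frac12\max(\|\rho_1\|,\|\rho_2\|)$. Then $(\mathcal{A}_1\oplus\mathcal{A}_2,\rho,\pi_1\oplus\pi_2)$ is a compact quantum metric space, where $$\rho=\rho_1+\rho_2+r\,1_{\mathcal{A}_1\otimes\mathcal{A}_2}+r\,1_{\mathcal{A}_2\otimes\mathcal{A}_1}\in\bigoplus_{i,j=1,2}\mathcal{A}_i\otimes\mathcal{A}_j=(\mathcal{A}_1\oplus\mathcal{A}_2)\otimes(\mathcal{A}_1\oplus\mathcal{A}_2).$$ -/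

import Mathlib

open scoped TensorProduct
open UniformSpace (Completion)

noncomputable section

set_option linter.unusedSectionVars false

namespace QuantumMetric

/-! ### Hilbert space tensor products and tensor products of operators -/

section Tensor

variable {H K L M : Type*}
  [NormedAddCommGroup H] [InnerProductSpace ℂ H]
  [NormedAddCommGroup K] [InnerProductSpace ℂ K]
  [NormedAddCommGroup L] [InnerProductSpace ℂ L]
  [NormedAddCommGroup M] [InnerProductSpace ℂ M]

/-- The Hilbert space tensor product: the completion of the algebraic tensor product with respect
to the inner product `⟪x ⊗ y, x' ⊗ y'⟫ = ⟪x, x'⟫ * ⟪y, y'⟫`. -/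
def HTensor (H K : Type*) [NormedAddCommGroup H] [InnerProductSpace ℂ H]
    [NormedAddCommGroup K] [InnerProductSpace ℂ K] : Type _ :=
  Completion (H ⊗[ℂ] K)

instance : NormedAddCommGroup (HTensor H K) :=
  inferInstanceAs (NormedAddCommGroup (Completion (H ⊗[ℂ] K)))

instance : InnerProductSpace ℂ (HTensor H K) :=
  inferInstanceAs (InnerProductSpace ℂ (Completion (H ⊗[ℂ] K)))

instance : CompleteSpace (HTensor H K) :=
  inferInstanceAs (CompleteSpace (Completion (H ⊗[ℂ] K)))

/-- The isometric inclusion of the algebraic tensor product. -/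
def incl (H K : Type*) [NormedAddCommGroup H] [InnerProductSpace ℂ H]
    [NormedAddCommGroup K] [InnerProductSpace ℂ K] : H ⊗[ℂ] K →ₗᵢ[ℂ] HTensor H K :=
  Completion.toComplₗᵢ

theorem denseRange_incl : DenseRange (incl H K) :=
  Completion.denseRange_coe (α := H ⊗[ℂ] K)

/-- The elementary tensor `x ⊗ y` in the Hilbert space tensor product. -/
def htmul (x : H) (y : K) : HTensor H K := incl H K (x ⊗ₜ[ℂ] y)

/-- The tensor product `S ⊗ T` of two bounded operators, acting on the Hilbert space tensor
product: the continuous extension of the algebraic tensor product of the operators. -/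
def opTensor (S : H →L[ℂ] L) (T : K →L[ℂ] M) : HTensor H K →L[ℂ] HTensor L M :=
  ((incl L M).toLinearMap ∘ₗ TensorProduct.map S.toLinearMap T.toLinearMap).extendOfNorm
    (incl H K).toLinearMap

theorem opTensor_htmul (S : H →L[ℂ] L) (T : K →L[ℂ] M) (x : H) (y : K) :
    opTensor S T (htmul x y) = htmul (S x) (T y) :=
  LinearMap.extendOfNorm_eq (e := (incl H K).toLinearMap) denseRange_incl
    ⟨‖TensorProduct.mapL S T‖, fun t => by
      have h := (TensorProduct.mapL S T).le_opNorm t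
      rw [TensorProduct.mapL_apply] at h
      simpa using h⟩ (x ⊗ₜ[ℂ] y)

/-- A closed subspace containing `x ⊗ y` for all `x, y` is everything. -/
theorem eq_top_of_htmul_mem {S : Submodule ℂ (HTensor H K)}
    (hS : IsClosed (S : Set (HTensor H K))) (h : ∀ x y, htmul x y ∈ S) : S = ⊤ := by
  rw [eq_top_iff]
  rintro z -
  refine denseRange_incl.induction_on (p := fun z => z ∈ S) z hS fun t => ?_
  induction t using TensorProduct.induction_on with
  | zero => rw [map_zero]; exact S.zero_mem
  | tmul x y => exact h x y
  | add a b ha hb => rw [map_add]; exact S.add_mem ha hb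

/-- Two bounded operators on `H ⊗ K` which agree on elementary tensors are equal. -/
theorem ext_htmul {F : Type*} [NormedAddCommGroup F] [NormedSpace ℂ F]
    {S T : HTensor H K →L[ℂ] F} (h : ∀ x y, S (htmul x y) = T (htmul x y)) : S = T := by
  have := eq_top_of_htmul_mem (S := LinearMap.eqLocus S.toLinearMap T.toLinearMap)
    (isClosed_eq S.continuous T.continuous) h
  ext z
  have hz : z ∈ LinearMap.eqLocus S.toLinearMap T.toLinearMap := by rw [this]; trivial
  exact hz

theorem inner_htmul (x x' : H) (y y' : K) :
    inner ℂ (htmul x y) (htmul x' y') = inner ℂ x x' * inner ℂ y y' := by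
  rw [htmul, htmul, LinearIsometry.inner_map_map, TensorProduct.inner_tmul]

theorem opTensor_mul (S S' : H →L[ℂ] H) (T T' : K →L[ℂ] K) :
    opTensor (S * S') (T * T') = opTensor S T * opTensor S' T' :=
  ext_htmul fun x y => by simp [opTensor_htmul]

theorem opTensor_one : opTensor (1 : H →L[ℂ] H) (1 : K →L[ℂ] K) = 1 :=
  ext_htmul fun x y => by simp [opTensor_htmul]

theorem adjoint_opTensor [CompleteSpace H] [CompleteSpace K] [CompleteSpace L] [CompleteSpace M]
    (S : H →L[ℂ] L) (T : K →L[ℂ] M) :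
    (opTensor S T).adjoint = opTensor S.adjoint T.adjoint := by
  have key : ∀ (v : L) (w : M), innerSL ℂ ((opTensor S T).adjoint (htmul v w)) =
      innerSL ℂ (opTensor S.adjoint T.adjoint (htmul v w)) := fun v w =>
    ext_htmul fun x y => by
      simp [opTensor_htmul, inner_htmul, ContinuousLinearMap.adjoint_inner_left]
  refine ext_htmul fun v w => ?_
  refine ext_inner_right ℂ fun z => ?_
  exact congrArg (fun f => f z) (key v w)

/-- The unitary `H ⊗ K → K ⊗ H`, `x ⊗ y ↦ y ⊗ x`. -/
def hflip (H K : Type*) [NormedAddCommGroup H] [InnerProductSpace ℂ H]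
    [NormedAddCommGroup K] [InnerProductSpace ℂ K] : HTensor H K ≃ₗᵢ[ℂ] HTensor K H :=
  (TensorProduct.comm ℂ H K).extendOfIsometry
    (incl H K).toLinearMap (incl K H).toLinearMap denseRange_incl denseRange_incl
    (fun x => by simp)

theorem hflip_htmul (x : H) (y : K) : hflip H K (htmul x y) = htmul y x :=
  LinearEquiv.extendOfIsometry_eq (TensorProduct.comm ℂ H K)
    (incl H K).toLinearMap (incl K H).toLinearMap denseRange_incl denseRange_incl
    (fun x => by simp) (x ⊗ₜ[ℂ] y)

/-- The isometric inclusion of the algebraic tensor product in `(H ⊗ K) ⊗ L`. -/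
def inclLeft (H K L : Type*) [NormedAddCommGroup H] [InnerProductSpace ℂ H]
    [NormedAddCommGroup K] [InnerProductSpace ℂ K]
    [NormedAddCommGroup L] [InnerProductSpace ℂ L] :
    (H ⊗[ℂ] K) ⊗[ℂ] L →ₗᵢ[ℂ] HTensor (HTensor H K) L :=
  (incl (HTensor H K) L).comp (LinearIsometry.rTensor L (incl H K))

/-- The isometric inclusion of the algebraic tensor product in `H ⊗ (K ⊗ L)`. -/
def inclRight (H K L : Type*) [NormedAddCommGroup H] [InnerProductSpace ℂ H]
    [NormedAddCommGroup K] [InnerProductSpace ℂ K]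
    [NormedAddCommGroup L] [InnerProductSpace ℂ L] :
    H ⊗[ℂ] (K ⊗[ℂ] L) →ₗᵢ[ℂ] HTensor H (HTensor K L) :=
  (incl H (HTensor K L)).comp (LinearIsometry.lTensor H (incl K L))

theorem inclLeft_tmul (x : H) (y : K) (z : L) :
    inclLeft H K L ((x ⊗ₜ[ℂ] y) ⊗ₜ[ℂ] z) = htmul (htmul x y) z := rfl

theorem inclRight_tmul (x : H) (y : K) (z : L) :
    inclRight H K L (x ⊗ₜ[ℂ] (y ⊗ₜ[ℂ] z)) = htmul x (htmul y z) := rfl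

theorem continuous_htmul : Continuous fun p : H × K => htmul p.1 p.2 :=
  (incl H K).continuous.comp TensorProduct.continuous_tmul

theorem denseRange_inclLeft : DenseRange (inclLeft H K L) := by
  have h := eq_top_of_htmul_mem
    (S := (LinearMap.range (inclLeft H K L).toLinearMap).topologicalClosure)
    (Submodule.isClosed_topologicalClosure _) (fun u z =>
      denseRange_incl.induction_on u
        ((Submodule.isClosed_topologicalClosure _).preimage
          (continuous_htmul.comp (continuous_id.prodMk continuous_const)))
        fun t => Submodule.le_topologicalClosure _ ⟨t ⊗ₜ[ℂ] z, rfl⟩)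
  exact fun z => by
    have : z ∈ (LinearMap.range (inclLeft H K L).toLinearMap).topologicalClosure := by
      rw [h]; trivial
    exact this

theorem denseRange_inclRight : DenseRange (inclRight H K L) := by
  have h := eq_top_of_htmul_mem
    (S := (LinearMap.range (inclRight H K L).toLinearMap).topologicalClosure)
    (Submodule.isClosed_topologicalClosure _) (fun x u =>
      denseRange_incl.induction_on u
        ((Submodule.isClosed_topologicalClosure _).preimage
          (continuous_htmul.comp (continuous_const.prodMk continuous_id)))
        fun t => Submodule.le_topologicalClosure _ ⟨x ⊗ₜ[ℂ] t, rfl⟩)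
  exact fun z => by
    have : z ∈ (LinearMap.range (inclRight H K L).toLinearMap).topologicalClosure := by
      rw [h]; trivial
    exact this

/-- A unitary between algebraic triple tensor products extends to their completions. -/
def tripleExtend {H' K' L' : Type*} [NormedAddCommGroup H'] [InnerProductSpace ℂ H']
    [NormedAddCommGroup K'] [InnerProductSpace ℂ K']
    [NormedAddCommGroup L'] [InnerProductSpace ℂ L']
    (e : (H ⊗[ℂ] K) ⊗[ℂ] L ≃ₗᵢ[ℂ] H' ⊗[ℂ] (K' ⊗[ℂ] L')) :
    HTensor (HTensor H K) L ≃ₗᵢ[ℂ] HTensor H' (HTensor K' L') :=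
  e.toLinearEquiv.extendOfIsometry
    (inclLeft H K L).toLinearMap (inclRight H' K' L').toLinearMap
    denseRange_inclLeft denseRange_inclRight
    (fun x => ((inclRight H' K' L').norm_map _).trans
      ((e.norm_map x).trans ((inclLeft H K L).norm_map x).symm))

theorem tripleExtend_inclLeft {H' K' L' : Type*} [NormedAddCommGroup H'] [InnerProductSpace ℂ H']
    [NormedAddCommGroup K'] [InnerProductSpace ℂ K']
    [NormedAddCommGroup L'] [InnerProductSpace ℂ L']
    (e : (H ⊗[ℂ] K) ⊗[ℂ] L ≃ₗᵢ[ℂ] H' ⊗[ℂ] (K' ⊗[ℂ] L')) (t : (H ⊗[ℂ] K) ⊗[ℂ] L) :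
    tripleExtend e (inclLeft H K L t) = inclRight H' K' L' (e t) :=
  LinearEquiv.extendOfIsometry_eq e.toLinearEquiv
    (inclLeft H K L).toLinearMap (inclRight H' K' L').toLinearMap
    denseRange_inclLeft denseRange_inclRight
    (fun x => ((inclRight H' K' L').norm_map _).trans
      ((e.norm_map x).trans ((inclLeft H K L).norm_map x).symm)) t

/-- The unitary `(H ⊗ K) ⊗ L → H ⊗ (K ⊗ L)`, `(x ⊗ y) ⊗ z ↦ x ⊗ (y ⊗ z)`. -/
def hassoc (H K L : Type*) [NormedAddCommGroup H] [InnerProductSpace ℂ H]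
    [NormedAddCommGroup K] [InnerProductSpace ℂ K]
    [NormedAddCommGroup L] [InnerProductSpace ℂ L] :
    HTensor (HTensor H K) L ≃ₗᵢ[ℂ] HTensor H (HTensor K L) :=
  tripleExtend (TensorProduct.assocIsometry ℂ H K L)

theorem hassoc_htmul (x : H) (y : K) (z : L) :
    hassoc H K L (htmul (htmul x y) z) = htmul x (htmul y z) :=
  tripleExtend_inclLeft _ ((x ⊗ₜ[ℂ] y) ⊗ₜ[ℂ] z)

theorem hassoc_symm_htmul (x : H) (y : K) (z : L) :
    (hassoc H K L).symm (htmul x (htmul y z)) = htmul (htmul x y) z := by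
  rw [LinearIsometryEquiv.symm_apply_eq, hassoc_htmul]

/-- The unitary `(H ⊗ L) ⊗ K → H ⊗ (K ⊗ L)`, `(x ⊗ z) ⊗ y ↦ x ⊗ (y ⊗ z)`. -/
def hmid (H K L : Type*) [NormedAddCommGroup H] [InnerProductSpace ℂ H]
    [NormedAddCommGroup K] [InnerProductSpace ℂ K]
    [NormedAddCommGroup L] [InnerProductSpace ℂ L] :
    HTensor (HTensor H L) K ≃ₗᵢ[ℂ] HTensor H (HTensor K L) :=
  tripleExtend ((TensorProduct.assocIsometry ℂ H L K).trans
    (LinearIsometryEquiv.lTensor H (TensorProduct.commIsometry ℂ L K)))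

theorem hmid_htmul (x : H) (y : K) (z : L) :
    hmid H K L (htmul (htmul x z) y) = htmul x (htmul y z) :=
  tripleExtend_inclLeft _ ((x ⊗ₜ[ℂ] z) ⊗ₜ[ℂ] y)

theorem hmid_symm_htmul (x : H) (y : K) (z : L) :
    (hmid H K L).symm (htmul x (htmul y z)) = htmul (htmul x z) y := by
  rw [LinearIsometryEquiv.symm_apply_eq, hmid_htmul]

/-- Two bounded operators on `H ⊗ (K ⊗ L)` which agree on elementary tensors are equal. -/
theorem ext_htmul₃ {F : Type*} [NormedAddCommGroup F] [NormedSpace ℂ F]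
    {S T : HTensor H (HTensor K L) →L[ℂ] F}
    (h : ∀ x y z, S (htmul x (htmul y z)) = T (htmul x (htmul y z))) : S = T := by
  refine ext_htmul fun x u => ?_
  have hc : Continuous fun u : HTensor K L => htmul x u :=
    continuous_htmul.comp (continuous_const.prodMk continuous_id)
  refine denseRange_incl.induction_on (p := fun u => S (htmul x u) = T (htmul x u)) u
    (isClosed_eq (S.continuous.comp hc) (T.continuous.comp hc)) fun t => ?_
  induction t using TensorProduct.induction_on with
  | zero => simp [htmul]
  | tmul y z => exact h x y z
  | add a b ha hb =>
    have e : htmul x (incl K L (a + b)) = htmul x (incl K L a) + htmul x (incl K L b) := by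
      simp only [htmul, map_add, TensorProduct.tmul_add]
    rw [e, map_add, map_add, ha, hb]

end Tensor

/-! ### The flip, the leg operators, and the morphism `a ⊗ b ↦ a ⊗ 1 ⊗ b` -/

section Legs

variable {H : Type*} [NormedAddCommGroup H] [InnerProductSpace ℂ H] [CompleteSpace H]

/-- The flip morphism `a ⊗ b ↦ b ⊗ a`. -/
def flip : (HTensor H H →L[ℂ] HTensor H H) ≃⋆ₐ[ℂ] (HTensor H H →L[ℂ] HTensor H H) :=
  (hflip H H).conjStarAlgEquiv

theorem flip_opTensor (S T : H →L[ℂ] H) : flip (opTensor S T) = opTensor T S := by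
  refine ext_htmul fun x y => ?_
  have h : (hflip H H).symm (htmul x y) = htmul y x := by
    rw [LinearIsometryEquiv.symm_apply_eq, hflip_htmul]
  simp [flip, h, opTensor_htmul, hflip_htmul]

theorem htmul_add_left {K : Type*} [NormedAddCommGroup K] [InnerProductSpace ℂ K]
    (x x' : H) (y : K) : htmul (x + x') y = htmul x y + htmul x' y := by
  simp only [htmul, map_add, TensorProduct.add_tmul]

theorem htmul_smul_left {K : Type*} [NormedAddCommGroup K] [InnerProductSpace ℂ K]
    (c : ℂ) (x : H) (y : K) : htmul (c • x) y = c • htmul x y := by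
  rw [htmul, ← TensorProduct.smul_tmul', map_smul]; rfl

theorem opTensor_add_one {K : Type*} [NormedAddCommGroup K] [InnerProductSpace ℂ K]
    (S T : H →L[ℂ] H) :
    opTensor (S + T) (1 : K →L[ℂ] K) = opTensor S 1 + opTensor T 1 :=
  ext_htmul fun x y => by
    simp [opTensor_htmul, htmul_add_left]

theorem opTensor_smul_one {K : Type*} [NormedAddCommGroup K] [InnerProductSpace ℂ K]
    (c : ℂ) (S : H →L[ℂ] H) :
    opTensor (c • S) (1 : K →L[ℂ] K) = c • opTensor S 1 :=
  ext_htmul fun x y => by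
    simp [opTensor_htmul, htmul_smul_left]

/-- The *-morphism `S ↦ S ⊗ 1`. -/
def ampliation (H K : Type*) [NormedAddCommGroup H] [InnerProductSpace ℂ H] [CompleteSpace H]
    [NormedAddCommGroup K] [InnerProductSpace ℂ K] [CompleteSpace K] :
    (H →L[ℂ] H) →⋆ₐ[ℂ] (HTensor H K →L[ℂ] HTensor H K) where
  toFun S := opTensor S 1
  map_one' := opTensor_one
  map_mul' S T := by rw [← opTensor_mul, one_mul]
  map_zero' := by simpa using opTensor_smul_one (K := K) 0 (0 : H →L[ℂ] H)
  map_add' S T := opTensor_add_one S T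
  commutes' c := by
    rw [Algebra.algebraMap_eq_smul_one, opTensor_smul_one, opTensor_one,
      Algebra.algebraMap_eq_smul_one]
  map_star' S := by
    rw [ContinuousLinearMap.star_eq_adjoint, ContinuousLinearMap.star_eq_adjoint,
      adjoint_opTensor]
    congr 1
    exact (star_one (K →L[ℂ] K)).symm

/-- The element `ρ ⊗ 1`, acting on the triple tensor product `H ⊗ (H ⊗ H)`. -/
def rightOne (ρ : HTensor H H →L[ℂ] HTensor H H) :
    HTensor H (HTensor H H) →L[ℂ] HTensor H (HTensor H H) :=
  (hassoc H H H).conjStarAlgEquiv (opTensor ρ 1)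

/-- The element `1 ⊗ ρ`, acting on the triple tensor product `H ⊗ (H ⊗ H)`. -/
def leftOne (ρ : HTensor H H →L[ℂ] HTensor H H) :
    HTensor H (HTensor H H) →L[ℂ] HTensor H (HTensor H H) :=
  opTensor 1 ρ

/-- The *-morphism that puts `1` in the mid position, `a ⊗ b ↦ a ⊗ 1 ⊗ b`. -/
def midOne : (HTensor H H →L[ℂ] HTensor H H) →⋆ₐ[ℂ]
    (HTensor H (HTensor H H) →L[ℂ] HTensor H (HTensor H H)) :=
  (StarAlgHomClass.toStarAlgHom (hmid H H H).conjStarAlgEquiv).comp (ampliation (HTensor H H) H)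

theorem rightOne_opTensor (S T : H →L[ℂ] H) :
    rightOne (opTensor S T) = opTensor S (opTensor T 1) :=
  ext_htmul₃ fun x y z => by
    simp [rightOne, hassoc_symm_htmul, opTensor_htmul, hassoc_htmul]

theorem midOne_opTensor (S T : H →L[ℂ] H) :
    midOne (opTensor S T) = opTensor S (opTensor 1 T) :=
  ext_htmul₃ fun x y z => by
    change hmid H H H (opTensor (opTensor S T) 1 ((hmid H H H).symm _)) = _
    simp [hmid_symm_htmul, opTensor_htmul, hmid_htmul]

end Legs

/-! ### Representations -/

section Rep

variable {A H : Type*} [CStarAlgebra A]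
  [NormedAddCommGroup H] [InnerProductSpace ℂ H] [CompleteSpace H]

/-- The subspace `V` of `H` is invariant under the representation `π`. -/
def IsInvariant (π : A →⋆ₐ[ℂ] (H →L[ℂ] H)) (V : Submodule ℂ H) : Prop :=
  ∀ a, ∀ x ∈ V, π a x ∈ V

/-- The subspace `V` is closed and invariant under `π`, and the representation obtained by restricting
`π` to `V` is irreducible. -/
structure IsIrreducibleSub (π : A →⋆ₐ[ℂ] (H →L[ℂ] H)) (V : Submodule ℂ H) : Prop where
  isClosed : IsClosed (V : Set H)
  invariant : IsInvariant π V
  ne_bot : V ≠ ⊥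
  irreducible : ∀ W : Submodule ℂ H, IsClosed (W : Set H) → IsInvariant π W → W ≤ V →
    W = ⊥ ∨ W = V

/-- The restrictions of `π` to the invariant subspaces `V` and `W` are unitarily equivalent. -/
def EquivalentSub (π : A →⋆ₐ[ℂ] (H →L[ℂ] H)) (V W : Submodule ℂ H) : Prop :=
  ∃ U : V ≃ₗᵢ[ℂ] W, ∀ (a : A) (x y : V), (y : H) = π a x → (U y : H) = π a (U x)

/-- `π` is atomic: it is the Hilbert space direct sum of a family of pairwise inequivalent
irreducible representations. -/
def IsAtomic.{u, v} {A : Type u} {H : Type v} [CStarAlgebra A]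
    [NormedAddCommGroup H] [InnerProductSpace ℂ H] [CompleteSpace H]
    (π : A →⋆ₐ[ℂ] (H →L[ℂ] H)) : Prop :=
  ∃ (ι : Type v) (V : ι → Submodule ℂ H),
    IsHilbertSum ℂ (fun i => V i) (fun i => (V i).subtypeₗᵢ) ∧
    (∀ i, IsIrreducibleSub π (V i)) ∧
    Pairwise fun i j => ¬ EquivalentSub π (V i) (V j)

/-- The enveloping von Neumann algebra: the double commutant of `π(A)`. -/
def envelope (π : A →⋆ₐ[ℂ] (H →L[ℂ] H)) : Set (H →L[ℂ] H) :=
  Set.centralizer (Set.centralizer (Set.range π))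

/-- `p` is a minimal projection of the enveloping von Neumann algebra of `π`. -/
structure IsMinimalProjection (π : A →⋆ₐ[ℂ] (H →L[ℂ] H)) (p : H →L[ℂ] H) : Prop where
  isStarProjection : IsStarProjection p
  mem : p ∈ envelope π
  ne_zero : p ≠ 0
  minimal : ∀ q ∈ envelope π, IsStarProjection q → q ≤ p → q = 0 ∨ q = p

/-- The range of the characteristic function of the diagonal: the closed linear span of the ranges
of the projections `p ⊗ p`, where `p` is a minimal projection of the enveloping algebra. -/
def diagSubspace (π : A →⋆ₐ[ℂ] (H →L[ℂ] H)) : Submodule ℂ (HTensor H H) :=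
  (⨆ (p : H →L[ℂ] H) (_ : IsMinimalProjection π p), (opTensor p p).range).topologicalClosure

instance (π : A →⋆ₐ[ℂ] (H →L[ℂ] H)) : CompleteSpace (diagSubspace π) :=
  (Submodule.isClosed_topologicalClosure _).completeSpace_coe

/-- The characteristic function of the diagonal `P_δ`: the supremum of all projections `p ⊗ p`
with `p` a minimal projection of the enveloping algebra. -/
def diagProj (π : A →⋆ₐ[ℂ] (H →L[ℂ] H)) : HTensor H H →L[ℂ] HTensor H H :=
  (diagSubspace π).starProjection

/-- `P_δ` is indeed the least projection that dominates all `p ⊗ p`. -/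
theorem diagProj_isLeast (π : A →⋆ₐ[ℂ] (H →L[ℂ] H)) :
    IsLeast {Q : HTensor H H →L[ℂ] HTensor H H | IsStarProjection Q ∧
      ∀ p, IsMinimalProjection π p → opTensor p p ≤ Q} (diagProj π) := by
  have hpp : ∀ p, IsMinimalProjection π p → IsStarProjection (opTensor p p) := fun p hp => by
    refine ⟨?_, ?_⟩
    · rw [IsIdempotentElem, ← opTensor_mul, hp.isStarProjection.isIdempotentElem.eq]
    · have h := hp.isStarProjection.isSelfAdjoint
      rw [ContinuousLinearMap.isSelfAdjoint_iff'] at h ⊢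
      rw [adjoint_opTensor, h]
  refine ⟨⟨isStarProjection_starProjection, fun p hp => ?_⟩, ?_⟩
  · obtain ⟨h1, h2⟩ := isStarProjection_iff_eq_starProjection_range.1 (hpp p hp)
    rw [h2, diagProj, Submodule.starProjection_le_starProjection_iff]
    exact (le_iSup₂ (f := fun (p : H →L[ℂ] H) (_ : IsMinimalProjection π p) =>
      (opTensor p p).range) p hp).trans (Submodule.le_topologicalClosure _)
  · rintro Q ⟨hQ, hle⟩
    obtain ⟨h1, h2⟩ := isStarProjection_iff_eq_starProjection_range.1 hQ
    rw [h2, diagProj, Submodule.starProjection_le_starProjection_iff]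
    refine Submodule.topologicalClosure_minimal _ (iSup₂_le fun p hp => ?_) ?_
    · obtain ⟨h3, h4⟩ :=
        isStarProjection_iff_eq_starProjection_range.1 (hpp p hp)
      have := hle p hp
      rwa [h2, h4, Submodule.starProjection_le_starProjection_iff] at this
    · exact ContinuousLinearMap.IsIdempotentElem.isClosed_range hQ.isIdempotentElem

/-- The spatial tensor product, realised through the representations `π₁` and `π₂`: the norm
closed *-algebra generated by the operators `π₁ a ⊗ π₂ b`. (For faithful representations this is
the spatial tensor product of the two C*-algebras.) -/
def spatialTensor {A₁ A₂ H₁ H₂ : Type*} [CStarAlgebra A₁] [CStarAlgebra A₂]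
    [NormedAddCommGroup H₁] [InnerProductSpace ℂ H₁] [CompleteSpace H₁]
    [NormedAddCommGroup H₂] [InnerProductSpace ℂ H₂] [CompleteSpace H₂]
    (π₁ : A₁ →⋆ₐ[ℂ] (H₁ →L[ℂ] H₁)) (π₂ : A₂ →⋆ₐ[ℂ] (H₂ →L[ℂ] H₂)) :
    StarSubalgebra ℂ (HTensor H₁ H₂ →L[ℂ] HTensor H₁ H₂) :=
  (StarAlgebra.adjoin ℂ {T | ∃ a b, T = opTensor (π₁ a) (π₂ b)}).topologicalClosure

/-- `ρ` is a (compatible) quantum metric with respect to `π`. -/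
structure IsQuantumMetric (π : A →⋆ₐ[ℂ] (H →L[ℂ] H)) (ρ : HTensor H H →L[ℂ] HTensor H H) :
    Prop where
  mem : ρ ∈ spatialTensor π π
  /-- Positivity, in the order of positive operators. -/
  nonneg : 0 ≤ ρ
  mul_diag : ρ * diagProj π = 0
  diag_mul : diagProj π * ρ = 0
  /-- `0` is not an eigenvalue of the restriction of `ρ` to the orthogonal complement of the range
  of `P_δ`. -/
  eq_zero_of_apply_eq_zero : ∀ x ∈ (diagSubspace π)ᗮ, ρ x = 0 → x = 0
  flip_eq : flip ρ = ρ
  triangle : midOne ρ ≤ rightOne ρ + leftOne ρ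

/-- `(A, ρ, π)` is a compact quantum metric space. -/
structure IsCompactQuantumMetricSpace (A : Type*) {H : Type*} [CStarAlgebra A]
    [NormedAddCommGroup H] [InnerProductSpace ℂ H] [CompleteSpace H]
    (ρ : HTensor H H →L[ℂ] HTensor H H) (π : A →⋆ₐ[ℂ] (H →L[ℂ] H)) : Prop where
  faithful : Function.Injective π
  atomic : IsAtomic π
  isQuantumMetric : IsQuantumMetric π ρ

end Rep

/-! ### Direct sums -/

section DirectSum

variable {A₁ A₂ H₁ H₂ : Type*} [CStarAlgebra A₁] [CStarAlgebra A₂]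
  [NormedAddCommGroup H₁] [InnerProductSpace ℂ H₁] [CompleteSpace H₁]
  [NormedAddCommGroup H₂] [InnerProductSpace ℂ H₂] [CompleteSpace H₂]

/-- The Hilbert space direct sum. -/
abbrev HSum (H₁ H₂ : Type*) [NormedAddCommGroup H₁] [InnerProductSpace ℂ H₁]
    [NormedAddCommGroup H₂] [InnerProductSpace ℂ H₂] : Type _ :=
  WithLp 2 (H₁ × H₂)

/-- The direct sum `S ⊕ T` of two bounded operators. -/
def opSum (S : H₁ →L[ℂ] H₁) (T : H₂ →L[ℂ] H₂) : HSum H₁ H₂ →L[ℂ] HSum H₁ H₂ :=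
  (WithLp.prodContinuousLinearEquiv 2 ℂ H₁ H₂).symm.toContinuousLinearMap ∘L
    S.prodMap T ∘L (WithLp.prodContinuousLinearEquiv 2 ℂ H₁ H₂).toContinuousLinearMap

theorem opSum_apply (S : H₁ →L[ℂ] H₁) (T : H₂ →L[ℂ] H₂) (x : HSum H₁ H₂) :
    opSum S T x = WithLp.toLp 2 (S x.fst, T x.snd) := rfl

/-- The direct sum `π₁ ⊕ π₂` of two representations, a representation of `A₁ ⊕ A₂`. -/
def repSum (π₁ : A₁ →⋆ₐ[ℂ] (H₁ →L[ℂ] H₁)) (π₂ : A₂ →⋆ₐ[ℂ] (H₂ →L[ℂ] H₂)) :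
    A₁ × A₂ →⋆ₐ[ℂ] (HSum H₁ H₂ →L[ℂ] HSum H₁ H₂) where
  toFun a := opSum (π₁ a.1) (π₂ a.2)
  map_one' := by ext x; apply WithLp.ofLp_injective; simp [opSum_apply]; rfl
  map_mul' a b := by ext x; apply WithLp.ofLp_injective; simp [opSum_apply]
  map_zero' := by ext x; apply WithLp.ofLp_injective; simp [opSum_apply]
  map_add' a b := by ext x; apply WithLp.ofLp_injective; simp [opSum_apply]
  commutes' c := by
    ext x
    apply WithLp.ofLp_injective
    simp [opSum_apply, Algebra.algebraMap_eq_smul_one]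
    rfl
  map_star' a := by
    rw [ContinuousLinearMap.star_eq_adjoint, ContinuousLinearMap.eq_adjoint_iff]
    intro x y
    simp [opSum_apply, map_star, ContinuousLinearMap.star_eq_adjoint,
      ContinuousLinearMap.adjoint_inner_left]

/-- The isometric inclusion of the first summand. -/
def inl (H₁ H₂ : Type*) [NormedAddCommGroup H₁] [InnerProductSpace ℂ H₁]
    [NormedAddCommGroup H₂] [InnerProductSpace ℂ H₂] : H₁ →L[ℂ] HSum H₁ H₂ :=
  (WithLp.prodContinuousLinearEquiv 2 ℂ H₁ H₂).symm.toContinuousLinearMap ∘L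
    ContinuousLinearMap.inl ℂ H₁ H₂

/-- The isometric inclusion of the second summand. -/
def inr (H₁ H₂ : Type*) [NormedAddCommGroup H₁] [InnerProductSpace ℂ H₁]
    [NormedAddCommGroup H₂] [InnerProductSpace ℂ H₂] : H₂ →L[ℂ] HSum H₁ H₂ :=
  (WithLp.prodContinuousLinearEquiv 2 ℂ H₁ H₂).symm.toContinuousLinearMap ∘L
    ContinuousLinearMap.inr ℂ H₁ H₂

/-- For an isometry `V : H → K`, the (non-unital) inclusion `ρ ↦ (V ⊗ V) ρ (V ⊗ V)*` of the
operators on `H ⊗ H` in those on `K ⊗ K`. -/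
def corner {H K : Type*} [NormedAddCommGroup H] [InnerProductSpace ℂ H] [CompleteSpace H]
    [NormedAddCommGroup K] [InnerProductSpace ℂ K] [CompleteSpace K]
    (V : H →L[ℂ] K) (ρ : HTensor H H →L[ℂ] HTensor H H) : HTensor K K →L[ℂ] HTensor K K :=
  opTensor V V ∘L ρ ∘L (opTensor V V).adjoint

theorem adjoint_inl_apply (x : HSum H₁ H₂) : (inl H₁ H₂).adjoint x = x.fst := by
  refine ext_inner_right ℂ fun y => ?_
  rw [ContinuousLinearMap.adjoint_inner_left]
  simp [inl]

theorem adjoint_inr_apply (x : HSum H₁ H₂) : (inr H₁ H₂).adjoint x = x.snd := by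
  refine ext_inner_right ℂ fun y => ?_
  rw [ContinuousLinearMap.adjoint_inner_left]
  simp [inr]

/-- On elementary tensors, `corner` is the inclusion of `A₁ ⊗ A₁` in `(A₁ ⊕ A₂) ⊗ (A₁ ⊕ A₂)`. -/
theorem corner_inl_opTensor (π₁ : A₁ →⋆ₐ[ℂ] (H₁ →L[ℂ] H₁)) (π₂ : A₂ →⋆ₐ[ℂ] (H₂ →L[ℂ] H₂))
    (a b : A₁) : corner (inl H₁ H₂) (opTensor (π₁ a) (π₁ b)) =
      opTensor (repSum π₁ π₂ (a, 0)) (repSum π₁ π₂ (b, 0)) := by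
  refine ext_htmul fun x y => ?_
  have h : ∀ c : A₁, ∀ z : HSum H₁ H₂,
      repSum π₁ π₂ (c, 0) z = inl H₁ H₂ (π₁ c z.fst) := fun c z => by
    change opSum (π₁ c) (π₂ 0) z = _
    simp [opSum_apply, inl]
  simp [corner, adjoint_opTensor, opTensor_htmul, adjoint_inl_apply, h]

/-- On elementary tensors, `corner` is the inclusion of `A₂ ⊗ A₂` in `(A₁ ⊕ A₂) ⊗ (A₁ ⊕ A₂)`. -/
theorem corner_inr_opTensor (π₁ : A₁ →⋆ₐ[ℂ] (H₁ →L[ℂ] H₁)) (π₂ : A₂ →⋆ₐ[ℂ] (H₂ →L[ℂ] H₂))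
    (a b : A₂) : corner (inr H₁ H₂) (opTensor (π₂ a) (π₂ b)) =
      opTensor (repSum π₁ π₂ (0, a)) (repSum π₁ π₂ (0, b)) := by
  refine ext_htmul fun x y => ?_
  have h : ∀ c : A₂, ∀ z : HSum H₁ H₂,
      repSum π₁ π₂ (0, c) z = inr H₁ H₂ (π₂ c z.snd) := fun c z => by
    change opSum (π₁ 0) (π₂ c) z = _
    simp [opSum_apply, inr]
  simp [corner, adjoint_opTensor, opTensor_htmul, adjoint_inr_apply, h]

/-- The element `ρ₁ + ρ₂ + r 1_{A₁ ⊗ A₂} + r 1_{A₂ ⊗ A₁}` of `(A₁ ⊕ A₂) ⊗ (A₁ ⊕ A₂)`. -/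
def sumMetric (π₁ : A₁ →⋆ₐ[ℂ] (H₁ →L[ℂ] H₁)) (π₂ : A₂ →⋆ₐ[ℂ] (H₂ →L[ℂ] H₂))
    (ρ₁ : HTensor H₁ H₁ →L[ℂ] HTensor H₁ H₁) (ρ₂ : HTensor H₂ H₂ →L[ℂ] HTensor H₂ H₂) (r : ℝ) :
    HTensor (HSum H₁ H₂) (HSum H₁ H₂) →L[ℂ] HTensor (HSum H₁ H₂) (HSum H₁ H₂) :=
  corner (inl H₁ H₂) ρ₁ + corner (inr H₁ H₂) ρ₂
    + (r : ℂ) • opTensor (repSum π₁ π₂ (1, 0)) (repSum π₁ π₂ (0, 1))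
    + (r : ℂ) • opTensor (repSum π₁ π₂ (0, 1)) (repSum π₁ π₂ (1, 0))

end DirectSum

end QuantumMetric

end

/-! Let `V` and `W` be the isometric inclusions of H₁ and H₂ in K = H₁ ⊕ H₂, and put e = VV*, f =
WW*, so that e + f = 1. The metric becomes X + Y + r e⊗f + r f⊗e, with X and Y the copies of ρ₁ and
ρ₂ in the corners e⊗e and f⊗f (`glue`, `sumMetric_eq_glue`). It is block diagonal for the splitting
of K⊗K into four blocks, and every axiom is checked block by block.

Triangle inequality (`midOne_glue_le`). Writing each 1 as e + f splits K⊗K⊗K into eight blocks. On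
eee and fff the claim is the triangle inequality of ρ₁ or ρ₂, conjugated by V⊗V⊗V or W⊗W⊗W. On eef,
ffe, fee and eff the terms in r cancel, and a positive operator such as X⊗f or f⊗X remains. On efe
the right side is 2r e⊗f⊗e and the left side is X on the outer legs with f in the middle; this is
where ‖ρ₁‖ ≤ 2r is needed. The block fef uses ‖ρ₂‖ ≤ 2r in the same way.

Diagonal. The double commutant of a direct sum is the direct sum of the double commutants, because 1
⊕ 0 lies in the represented algebra (`centralizer_image2_opSum`, `envelope_repSum`). Hence every
minimal projection has the form q ⊕ 0 or 0 ⊕ q with q minimal (`IsMinimalProjection.eq_opSum`), and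
the diagonal subspace lives in the corners e⊗e and f⊗f, where the hypotheses on ρ₁ and ρ₂ apply. On
the mixed blocks the metric is the scalar r ≠ 0, so no kernel arises there (`sumMetric_kernel`).

Membership in the spatial tensor product holds because `corner` is a continuous, non-unital
*-morphism sending generators to generators. Atomicity holds because the irreducible subspaces of
both summands together decompose K, and the element (1, 0) tells those of H₁ from those of H₂. -/

noncomputable section

set_option linter.unusedSectionVars false

namespace QuantumMetric

/-! ### Bilinearity and functoriality of the tensor product of operators. -/

section TensorAlgebra

variable {H K L M : Type*}
  [NormedAddCommGroup H] [InnerProductSpace ℂ H]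
  [NormedAddCommGroup K] [InnerProductSpace ℂ K]
  [NormedAddCommGroup L] [InnerProductSpace ℂ L]
  [NormedAddCommGroup M] [InnerProductSpace ℂ M]

theorem htmul_add (x x' : H) (y : K) : htmul (x + x') y = htmul x y + htmul x' y := by
  simp only [htmul, map_add, TensorProduct.add_tmul]

theorem htmul_add_right (x : H) (y y' : K) : htmul x (y + y') = htmul x y + htmul x y' := by
  simp only [htmul, map_add, TensorProduct.tmul_add]

theorem smul_htmul (c : ℂ) (x : H) (y : K) : htmul (c • x) y = c • htmul x y := by
  rw [htmul, ← TensorProduct.smul_tmul', map_smul]; rfl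

theorem zero_htmul (y : K) : htmul (0 : H) y = 0 := by
  simp only [htmul, TensorProduct.zero_tmul, map_zero]

theorem htmul_zero (x : H) : htmul x (0 : K) = 0 := by
  simp only [htmul, TensorProduct.tmul_zero, map_zero]

theorem opTensor_comp {H' K' : Type*} [NormedAddCommGroup H'] [InnerProductSpace ℂ H']
    [NormedAddCommGroup K'] [InnerProductSpace ℂ K']
    (S : H →L[ℂ] L) (S' : H' →L[ℂ] H) (T : K →L[ℂ] M) (T' : K' →L[ℂ] K) :
    opTensor (S ∘L S') (T ∘L T') = opTensor S T ∘L opTensor S' T' :=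
  ext_htmul fun x y => by simp [opTensor_htmul]

theorem opTensor_add_left (S S' : H →L[ℂ] L) (T : K →L[ℂ] M) :
    opTensor (S + S') T = opTensor S T + opTensor S' T :=
  ext_htmul fun x y => by simp [opTensor_htmul, htmul_add]

theorem opTensor_add_right (S : H →L[ℂ] L) (T T' : K →L[ℂ] M) :
    opTensor S (T + T') = opTensor S T + opTensor S T' :=
  ext_htmul fun x y => by simp [opTensor_htmul, htmul_add_right]

theorem smul_opTensor (c : ℂ) (S : H →L[ℂ] L) (T : K →L[ℂ] M) :
    opTensor (c • S) T = c • opTensor S T :=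
  ext_htmul fun x y => by simp [opTensor_htmul, smul_htmul]

theorem opTensor_smul (c : ℂ) (S : H →L[ℂ] L) (T : K →L[ℂ] M) :
    opTensor S (c • T) = c • opTensor S T :=
  ext_htmul fun x y => by
    have h : ∀ (x : L) (y : M), htmul x (c • y) = c • htmul x y := fun x y => by
      rw [htmul, TensorProduct.tmul_smul, map_smul]; rfl
    simp [opTensor_htmul, h]

theorem zero_opTensor (T : K →L[ℂ] M) : opTensor (0 : H →L[ℂ] L) T = 0 :=
  ext_htmul fun x y => by simp [opTensor_htmul, zero_htmul]

theorem opTensor_zero (S : H →L[ℂ] L) : opTensor S (0 : K →L[ℂ] M) = 0 :=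
  ext_htmul fun x y => by simp [opTensor_htmul, htmul_zero]

end TensorAlgebra

/-! ### Operations that preserve positivity. -/

section Positivity

variable {H K : Type*}
  [NormedAddCommGroup H] [InnerProductSpace ℂ H] [CompleteSpace H]
  [NormedAddCommGroup K] [InnerProductSpace ℂ K] [CompleteSpace K]

/-- With S = s*s and T = t*t, the tensor product is (s⊗t)*(s⊗t). -/
theorem opTensor_nonneg {S : H →L[ℂ] H} {T : K →L[ℂ] K} (hS : 0 ≤ S) (hT : 0 ≤ T) :
    0 ≤ opTensor S T := by
  obtain ⟨s, rfl⟩ := CStarAlgebra.nonneg_iff_eq_star_mul_self.1 hS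
  obtain ⟨t, rfl⟩ := CStarAlgebra.nonneg_iff_eq_star_mul_self.1 hT
  rw [opTensor_mul, ContinuousLinearMap.star_eq_adjoint, ContinuousLinearMap.star_eq_adjoint,
    ← adjoint_opTensor, ← ContinuousLinearMap.star_eq_adjoint]
  exact star_mul_self_nonneg _

theorem conj_nonneg (V : H →L[ℂ] K) {T : H →L[ℂ] H} (hT : 0 ≤ T) : 0 ≤ V ∘L T ∘L V.adjoint := by
  rw [ContinuousLinearMap.nonneg_iff_isPositive] at hT ⊢
  exact hT.conj_adjoint V

theorem conjStarAlgEquiv_nonneg (e : H ≃ₗᵢ[ℂ] K) {T : H →L[ℂ] H} (hT : 0 ≤ T) :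
    0 ≤ e.conjStarAlgEquiv T := by
  obtain ⟨s, rfl⟩ := CStarAlgebra.nonneg_iff_eq_star_mul_self.1 hT
  rw [map_mul, map_star]
  exact star_mul_self_nonneg _

theorem conjStarAlgEquiv_add (e : H ≃ₗᵢ[ℂ] K) (S T : H →L[ℂ] H) :
    e.conjStarAlgEquiv (S + T) = e.conjStarAlgEquiv S + e.conjStarAlgEquiv T :=
  map_add _ _ _

theorem conjStarAlgEquiv_smul (e : H ≃ₗᵢ[ℂ] K) (c : ℂ) (T : H →L[ℂ] H) :
    e.conjStarAlgEquiv (c • T) = c • e.conjStarAlgEquiv T :=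
  map_smul _ _ _

theorem corner_nonneg (V : H →L[ℂ] K) {ρ : HTensor H H →L[ℂ] HTensor H H} (hρ : 0 ≤ ρ) :
    0 ≤ corner V ρ :=
  conj_nonneg _ hρ

end Positivity

/-! ### Operators on triple tensor products and their behaviour on corners. -/

section Legs

variable {H K : Type*}
  [NormedAddCommGroup H] [InnerProductSpace ℂ H] [CompleteSpace H]
  [NormedAddCommGroup K] [InnerProductSpace ℂ K] [CompleteSpace K]

/-- The operator `X ⊗ e` on `H ⊗ (H ⊗ H)`, with `X` acting on the first two legs. -/
def rightLeg (X : HTensor H H →L[ℂ] HTensor H H) (e : H →L[ℂ] H) :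
    HTensor H (HTensor H H) →L[ℂ] HTensor H (HTensor H H) :=
  (hassoc H H H).conjStarAlgEquiv (opTensor X e)

/-- The operator on `H ⊗ (H ⊗ H)` that acts by `X` on the outer legs and by `e` on the mid one. -/
def midLeg (X : HTensor H H →L[ℂ] HTensor H H) (e : H →L[ℂ] H) :
    HTensor H (HTensor H H) →L[ℂ] HTensor H (HTensor H H) :=
  (hmid H H H).conjStarAlgEquiv (opTensor X e)

theorem rightOne_eq_rightLeg (X : HTensor H H →L[ℂ] HTensor H H) : rightOne X = rightLeg X 1 := rfl

theorem midOne_eq_midLeg (X : HTensor H H →L[ℂ] HTensor H H) : midOne X = midLeg X 1 := rfl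

theorem rightLeg_opTensor (S T U : H →L[ℂ] H) :
    rightLeg (opTensor S T) U = opTensor S (opTensor T U) :=
  ext_htmul₃ fun x y z => by
    simp [rightLeg, hassoc_symm_htmul, opTensor_htmul, hassoc_htmul]

theorem midLeg_opTensor (S T U : H →L[ℂ] H) :
    midLeg (opTensor S T) U = opTensor S (opTensor U T) :=
  ext_htmul₃ fun x y z => by
    simp [midLeg, hmid_symm_htmul, opTensor_htmul, hmid_htmul]

theorem rightLeg_add_left (X Y : HTensor H H →L[ℂ] HTensor H H) (e : H →L[ℂ] H) :
    rightLeg (X + Y) e = rightLeg X e + rightLeg Y e := by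
  rw [rightLeg, opTensor_add_left, conjStarAlgEquiv_add]; rfl

theorem rightLeg_add_right (X : HTensor H H →L[ℂ] HTensor H H) (e f : H →L[ℂ] H) :
    rightLeg X (e + f) = rightLeg X e + rightLeg X f := by
  rw [rightLeg, opTensor_add_right, conjStarAlgEquiv_add]; rfl

theorem rightLeg_smul (c : ℂ) (X : HTensor H H →L[ℂ] HTensor H H) (e : H →L[ℂ] H) :
    rightLeg (c • X) e = c • rightLeg X e := by
  rw [rightLeg, smul_opTensor, conjStarAlgEquiv_smul]; rfl

theorem midLeg_add_left (X Y : HTensor H H →L[ℂ] HTensor H H) (e : H →L[ℂ] H) :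
    midLeg (X + Y) e = midLeg X e + midLeg Y e := by
  rw [midLeg, opTensor_add_left, conjStarAlgEquiv_add]; rfl

theorem midLeg_add_right (X : HTensor H H →L[ℂ] HTensor H H) (e f : H →L[ℂ] H) :
    midLeg X (e + f) = midLeg X e + midLeg X f := by
  rw [midLeg, opTensor_add_right, conjStarAlgEquiv_add]; rfl

theorem midLeg_smul (c : ℂ) (X : HTensor H H →L[ℂ] HTensor H H) (e : H →L[ℂ] H) :
    midLeg (c • X) e = c • midLeg X e := by
  rw [midLeg, smul_opTensor, conjStarAlgEquiv_smul]; rfl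

theorem rightLeg_nonneg {X : HTensor H H →L[ℂ] HTensor H H} {e : H →L[ℂ] H} (hX : 0 ≤ X)
    (he : 0 ≤ e) : 0 ≤ rightLeg X e :=
  conjStarAlgEquiv_nonneg _ (opTensor_nonneg hX he)

theorem midLeg_nonneg {X : HTensor H H →L[ℂ] HTensor H H} {e : H →L[ℂ] H} (hX : 0 ≤ X)
    (he : 0 ≤ e) : 0 ≤ midLeg X e :=
  conjStarAlgEquiv_nonneg _ (opTensor_nonneg hX he)

/-- Naturality of the associator. With the analogues for `hmid` and `hflip`, it lets conjugation by
V⊗V⊗V or V⊗V pass through the rearrangements of the legs. -/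
theorem hassoc_symm_opTensor (S T U : H →L[ℂ] K) (z : HTensor H (HTensor H H)) :
    (hassoc K K K).symm (opTensor S (opTensor T U) z) =
      opTensor (opTensor S T) U ((hassoc H H H).symm z) := by
  have h : ((hassoc K K K).symm.toContinuousLinearEquiv : _ →L[ℂ] _) ∘L
      opTensor S (opTensor T U) = opTensor (opTensor S T) U ∘L
        ((hassoc H H H).symm.toContinuousLinearEquiv : _ →L[ℂ] _) :=
    ext_htmul₃ fun x y z => by simp [opTensor_htmul, hassoc_symm_htmul]
  exact congrArg (fun f => f z) h

theorem hassoc_opTensor (S T U : H →L[ℂ] K) (z : HTensor (HTensor H H) H) :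
    hassoc K K K (opTensor (opTensor S T) U z) =
      opTensor S (opTensor T U) (hassoc H H H z) := by
  rw [← LinearIsometryEquiv.eq_symm_apply, hassoc_symm_opTensor, LinearIsometryEquiv.symm_apply_apply]

theorem hmid_symm_opTensor (S T U : H →L[ℂ] K) (z : HTensor H (HTensor H H)) :
    (hmid K K K).symm (opTensor S (opTensor T U) z) =
      opTensor (opTensor S U) T ((hmid H H H).symm z) := by
  have h : ((hmid K K K).symm.toContinuousLinearEquiv : _ →L[ℂ] _) ∘L
      opTensor S (opTensor T U) = opTensor (opTensor S U) T ∘L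
        ((hmid H H H).symm.toContinuousLinearEquiv : _ →L[ℂ] _) :=
    ext_htmul₃ fun x y z => by simp [opTensor_htmul, hmid_symm_htmul]
  exact congrArg (fun f => f z) h

theorem hmid_opTensor (S T U : H →L[ℂ] K) (z : HTensor (HTensor H H) H) :
    hmid K K K (opTensor (opTensor S U) T z) =
      opTensor S (opTensor T U) (hmid H H H z) := by
  rw [← LinearIsometryEquiv.eq_symm_apply, hmid_symm_opTensor, LinearIsometryEquiv.symm_apply_apply]

theorem hflip_opTensor (S T : H →L[ℂ] K) (z : HTensor H H) :
    hflip K K (opTensor S T z) = opTensor T S (hflip H H z) := by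
  have h : ((hflip K K).toContinuousLinearEquiv : _ →L[ℂ] _) ∘L opTensor S T =
      opTensor T S ∘L ((hflip H H).toContinuousLinearEquiv : _ →L[ℂ] _) :=
    ext_htmul fun x y => by simp [opTensor_htmul, hflip_htmul]
  exact congrArg (fun f => f z) h

theorem hflip_symm_opTensor (S T : H →L[ℂ] K) (z : HTensor H H) :
    (hflip K K).symm (opTensor S T z) = opTensor T S ((hflip H H).symm z) := by
  rw [LinearIsometryEquiv.symm_apply_eq, hflip_opTensor, LinearIsometryEquiv.apply_symm_apply]

theorem flip_corner (V : H →L[ℂ] K) (ρ : HTensor H H →L[ℂ] HTensor H H) :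
    flip (corner V ρ) = corner V (flip ρ) := by
  ext z
  simp [flip, corner, adjoint_opTensor, hflip_opTensor, hflip_symm_opTensor]

/-- The remaining leg carries VV* instead of 1, which makes the whole operator a conjugate by V⊗V⊗V.
Together with the two companions below, this transports the triangle inequality of ρ. -/
theorem rightLeg_corner (V : H →L[ℂ] K) (ρ : HTensor H H →L[ℂ] HTensor H H) :
    rightLeg (corner V ρ) (V ∘L V.adjoint) =
      opTensor V (opTensor V V) ∘L rightOne ρ ∘L (opTensor V (opTensor V V)).adjoint := by
  have h : opTensor (corner V ρ) (V ∘L V.adjoint) = opTensor (opTensor V V) V ∘L opTensor ρ 1 ∘L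
      opTensor (opTensor V.adjoint V.adjoint) V.adjoint := by
    rw [← opTensor_comp, ← opTensor_comp, corner, adjoint_opTensor]; rfl
  ext z
  simp [rightLeg, rightOne, h, adjoint_opTensor, hassoc_opTensor, hassoc_symm_opTensor]

theorem midLeg_corner (V : H →L[ℂ] K) (ρ : HTensor H H →L[ℂ] HTensor H H) :
    midLeg (corner V ρ) (V ∘L V.adjoint) =
      opTensor V (opTensor V V) ∘L midOne ρ ∘L (opTensor V (opTensor V V)).adjoint := by
  have h : opTensor (corner V ρ) (V ∘L V.adjoint) = opTensor (opTensor V V) V ∘L opTensor ρ 1 ∘L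
      opTensor (opTensor V.adjoint V.adjoint) V.adjoint := by
    rw [← opTensor_comp, ← opTensor_comp, corner, adjoint_opTensor]; rfl
  ext z
  simp [midOne_eq_midLeg, midLeg, h, adjoint_opTensor, hmid_opTensor, hmid_symm_opTensor]

theorem opTensor_corner (V : H →L[ℂ] K) (ρ : HTensor H H →L[ℂ] HTensor H H) :
    opTensor (V ∘L V.adjoint) (corner V ρ) =
      opTensor V (opTensor V V) ∘L leftOne ρ ∘L (opTensor V (opTensor V V)).adjoint := by
  rw [leftOne, adjoint_opTensor V, ← opTensor_comp, ← opTensor_comp]; rfl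

/-- Conjugation by V⊗V⊗V preserves order. This settles the blocks eee and fff. -/
theorem midLeg_corner_le {V : H →L[ℂ] K} {ρ : HTensor H H →L[ℂ] HTensor H H}
    (h : midOne ρ ≤ rightOne ρ + leftOne ρ) :
    midLeg (corner V ρ) (V ∘L V.adjoint) ≤
      rightLeg (corner V ρ) (V ∘L V.adjoint) + opTensor (V ∘L V.adjoint) (corner V ρ) := by
  rw [← sub_nonneg] at h ⊢
  rw [rightLeg_corner, midLeg_corner, opTensor_corner]
  convert conj_nonneg (opTensor V (opTensor V V)) h using 1
  ext z
  simp

/-- Conjugate ρ ≤ ‖ρ‖ 1 ≤ c 1 by V⊗V. With c = 2r this is the bound used on the blocks efe and fef.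
-/
theorem corner_le {V : H →L[ℂ] K} {ρ : HTensor H H →L[ℂ] HTensor H H} (hρ : 0 ≤ ρ) {c : ℝ}
    (hc : ‖ρ‖ ≤ c) : corner V ρ ≤ (c : ℂ) • opTensor (V ∘L V.adjoint) (V ∘L V.adjoint) := by
  have h : ρ ≤ (c : ℂ) • 1 := by
    have h1 := (IsSelfAdjoint.of_nonneg hρ).le_algebraMap_norm_self
    have h2 : algebraMap ℝ (HTensor H H →L[ℂ] HTensor H H) ‖ρ‖ ≤ algebraMap ℝ _ c :=
      algebraMap_mono _ hc
    refine (h1.trans h2).trans_eq ?_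
    rw [Algebra.algebraMap_eq_smul_one, Complex.coe_smul]
  rw [← sub_nonneg] at h ⊢
  convert conj_nonneg (opTensor V V) h using 1
  rw [opTensor_comp, adjoint_opTensor, corner, adjoint_opTensor]
  ext z
  simp

end Legs

/-! ### The glued operator: positivity, symmetry, triangle inequality, kernel. -/

section Glue

variable {H₁ H₂ K : Type*}
  [NormedAddCommGroup H₁] [InnerProductSpace ℂ H₁] [CompleteSpace H₁]
  [NormedAddCommGroup H₂] [InnerProductSpace ℂ H₂] [CompleteSpace H₂]
  [NormedAddCommGroup K] [InnerProductSpace ℂ K] [CompleteSpace K]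

/-- `V` and `W` are isometries whose ranges are orthogonal complements of each other. -/
structure IsSplitting (V : H₁ →L[ℂ] K) (W : H₂ →L[ℂ] K) : Prop where
  left : V.adjoint ∘L V = 1
  right : W.adjoint ∘L W = 1
  add : V ∘L V.adjoint + W ∘L W.adjoint = 1

/-- The operator with diagonal blocks `ρ₁` and `ρ₂`, and `r` on the two mixed blocks. -/
def glue (V : H₁ →L[ℂ] K) (W : H₂ →L[ℂ] K) (ρ₁ : HTensor H₁ H₁ →L[ℂ] HTensor H₁ H₁)
    (ρ₂ : HTensor H₂ H₂ →L[ℂ] HTensor H₂ H₂) (r : ℝ) : HTensor K K →L[ℂ] HTensor K K :=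
  corner V ρ₁ + corner W ρ₂ + (r : ℂ) • opTensor (V ∘L V.adjoint) (W ∘L W.adjoint)
    + (r : ℂ) • opTensor (W ∘L W.adjoint) (V ∘L V.adjoint)

variable {V : H₁ →L[ℂ] K} {W : H₂ →L[ℂ] K} {ρ₁ : HTensor H₁ H₁ →L[ℂ] HTensor H₁ H₁}
  {ρ₂ : HTensor H₂ H₂ →L[ℂ] HTensor H₂ H₂} {r : ℝ}

theorem glue_comm : glue V W ρ₁ ρ₂ r = glue W V ρ₂ ρ₁ r := by
  simp only [glue]; abel

theorem comp_adjoint_nonneg (V : H₁ →L[ℂ] K) : 0 ≤ V ∘L V.adjoint := by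
  rw [ContinuousLinearMap.nonneg_iff_isPositive]
  exact ContinuousLinearMap.isPositive_self_comp_adjoint V

theorem complex_smul_nonneg {T : K →L[ℂ] K} (hr : 0 ≤ r) (hT : 0 ≤ T) : 0 ≤ (r : ℂ) • T := by
  rw [ContinuousLinearMap.nonneg_iff_isPositive] at hT ⊢
  exact hT.smul_of_nonneg (by exact_mod_cast hr)

theorem glue_nonneg (h₁ : 0 ≤ ρ₁) (h₂ : 0 ≤ ρ₂) (hr : 0 ≤ r) : 0 ≤ glue V W ρ₁ ρ₂ r :=
  add_nonneg (add_nonneg (add_nonneg (corner_nonneg V h₁) (corner_nonneg W h₂))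
    (complex_smul_nonneg hr (opTensor_nonneg (comp_adjoint_nonneg V) (comp_adjoint_nonneg W))))
    (complex_smul_nonneg hr (opTensor_nonneg (comp_adjoint_nonneg W) (comp_adjoint_nonneg V)))

theorem flip_glue (h₁ : flip ρ₁ = ρ₁) (h₂ : flip ρ₂ = ρ₂) :
    flip (glue V W ρ₁ ρ₂ r) = glue V W ρ₁ ρ₂ r := by
  have hs : ∀ (c : ℂ) (S : HTensor K K →L[ℂ] HTensor K K), flip (c • S) = c • flip S :=
    fun c S => by ext z; simp [flip]
  have ha : ∀ S T : HTensor K K →L[ℂ] HTensor K K, flip (S + T) = flip S + flip T :=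
    fun S T => by ext z; simp [flip]
  simp only [glue, ha, hs, flip_opTensor, flip_corner, h₁, h₂]
  abel

/-- The triangle inequality for the glued operator. -/
theorem midOne_glue_le (hVW : IsSplitting V W) (h₁ : 0 ≤ ρ₁) (h₂ : 0 ≤ ρ₂)
    (t₁ : midOne ρ₁ ≤ rightOne ρ₁ + leftOne ρ₁) (t₂ : midOne ρ₂ ≤ rightOne ρ₂ + leftOne ρ₂)
    (hr₁ : ‖ρ₁‖ ≤ 2 * r) (hr₂ : ‖ρ₂‖ ≤ 2 * r) :
    midOne (glue V W ρ₁ ρ₂ r) ≤ rightOne (glue V W ρ₁ ρ₂ r) + leftOne (glue V W ρ₁ ρ₂ r) := by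
  have hX := corner_nonneg V h₁
  have hY := corner_nonneg W h₂
  have he := comp_adjoint_nonneg V
  have hf := comp_adjoint_nonneg W
  -- One positive operator for each of the eight blocks: `a₁`, `a₂` for eee and fff; `b₁`, `b₂` for
  -- efe and fef; `c₁`, `c₂` for eef and ffe; `d₁`, `d₂` for fee and eff.
  have a₁ := sub_nonneg.2 (midLeg_corner_le (V := V) t₁)
  have a₂ := sub_nonneg.2 (midLeg_corner_le (V := W) t₂)
  have b₁ := midLeg_nonneg (sub_nonneg.2 (corner_le (V := V) h₁ hr₁)) hf
  have b₂ := midLeg_nonneg (sub_nonneg.2 (corner_le (V := W) h₂ hr₂)) he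
  have c₁ := rightLeg_nonneg hX hf
  have c₂ := rightLeg_nonneg hY he
  have d₁ := opTensor_nonneg hf hX
  have d₂ := opTensor_nonneg he hY
  have hadd := hVW.add
  -- Replacing the 1 on the free leg by VV* + WW* is what produces the blocks.
  rw [leftOne, rightOne_eq_rightLeg, midOne_eq_midLeg, ← hadd]
  simp only [glue]
  set X := corner V ρ₁
  set Y := corner W ρ₂
  set e := V ∘L V.adjoint
  set f := W ∘L W.adjoint
  have hsub : ∀ (S T : HTensor K K →L[ℂ] HTensor K K) g,
      midLeg (S - T) g = midLeg S g - midLeg T g := fun S T g => by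
    rw [eq_sub_iff_add_eq, ← midLeg_add_left, sub_add_cancel]
  -- On efe and fef, one r comes from ρ⊗1 and the other from 1⊗ρ.
  have hc : ((2 * r : ℝ) : ℂ) = r + r := by push_cast; ring
  rw [hsub, midLeg_smul, midLeg_opTensor, hc, add_smul] at b₁ b₂
  simp only [rightLeg_add_left, rightLeg_add_right, midLeg_add_left, midLeg_add_right,
    opTensor_add_left, opTensor_add_right, rightLeg_smul, midLeg_smul, opTensor_smul,
    rightLeg_opTensor, midLeg_opTensor, smul_add]
  rw [← sub_nonneg]
  -- The difference of the two sides is exactly the sum of the eight positive operators. The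
  -- remaining terms in r, one pair on each of eef, ffe, fee and eff, cancel.
  refine (add_nonneg (add_nonneg (add_nonneg a₁ a₂) (add_nonneg b₁ b₂))
    (add_nonneg (add_nonneg c₁ c₂) (add_nonneg d₁ d₂))).trans_eq ?_
  abel

namespace IsSplitting

theorem symm (h : IsSplitting V W) : IsSplitting W V :=
  ⟨h.right, h.left, by rw [add_comm, h.add]⟩

/-- Multiplying VV* + WW* = 1 by V gives V + WW*V = V, so WW*V = 0; then apply W* and use W*W = 1.
-/
theorem adjoint_comp (h : IsSplitting V W) : W.adjoint ∘L V = 0 := by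
  have h1 : (V ∘L V.adjoint) ∘L V + (W ∘L W.adjoint) ∘L V = V := by
    rw [← ContinuousLinearMap.add_comp, h.add]; rfl
  have h2 : W ∘L W.adjoint ∘L V = 0 := by
    rw [ContinuousLinearMap.comp_assoc, h.left] at h1
    exact left_eq_add.1 h1.symm
  have h3 : (W.adjoint ∘L W) ∘L W.adjoint ∘L V = W.adjoint ∘L W ∘L W.adjoint ∘L V := rfl
  rw [h.right, h2, ContinuousLinearMap.comp_zero] at h3
  exact h3

theorem adjoint_opTensor_comp (h : IsSplitting V W) :
    (opTensor V V).adjoint ∘L opTensor V V = 1 := by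
  rw [adjoint_opTensor, ← opTensor_comp, h.left, opTensor_one]

/-- The compression V*⊗V* kills every summand except the corner of ρ₁, since V*W = 0. Hence a kernel
vector of the glued operator has its e⊗e block in the kernel of ρ₁. -/
theorem adjoint_opTensor_glue (h : IsSplitting V W) (x : HTensor K K) :
    opTensor V.adjoint V.adjoint (glue V W ρ₁ ρ₂ r x) =
      ρ₁ (opTensor V.adjoint V.adjoint x) := by
  have hv : opTensor V.adjoint V.adjoint ∘L opTensor V V = 1 := by
    rw [← opTensor_comp, h.left, opTensor_one]
  have hw : opTensor V.adjoint V.adjoint ∘L opTensor W W = 0 := by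
    rw [← opTensor_comp, h.symm.adjoint_comp, zero_opTensor]
  have hvw : V.adjoint ∘L W ∘L W.adjoint = 0 := by
    rw [← ContinuousLinearMap.comp_assoc, h.symm.adjoint_comp, ContinuousLinearMap.zero_comp]
  have h1 : opTensor V.adjoint V.adjoint ∘L glue V W ρ₁ ρ₂ r =
      ρ₁ ∘L opTensor V.adjoint V.adjoint := by
    simp only [glue, corner, ContinuousLinearMap.comp_add, ContinuousLinearMap.comp_smul,
      ← opTensor_comp, hvw, zero_opTensor, opTensor_zero, smul_zero, add_zero]
    rw [← ContinuousLinearMap.comp_assoc _ (opTensor V V), hv,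
      ← ContinuousLinearMap.comp_assoc _ (opTensor W W), hw,
      ContinuousLinearMap.zero_comp, add_zero, adjoint_opTensor]
    rfl
  exact congrArg (fun f => f x) h1

/-- Only the summand r e⊗f survives V*⊗W*. The operator is therefore injective on this mixed block
as soon as r ≠ 0. -/
theorem opTensor_glue (h : IsSplitting V W) (x : HTensor K K) :
    opTensor V.adjoint W.adjoint (glue V W ρ₁ ρ₂ r x) =
      (r : ℂ) • opTensor V.adjoint W.adjoint x := by
  have hv : opTensor V.adjoint W.adjoint ∘L opTensor V V = 0 := by
    rw [← opTensor_comp, h.adjoint_comp, opTensor_zero]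
  have hw : opTensor V.adjoint W.adjoint ∘L opTensor W W = 0 := by
    rw [← opTensor_comp, h.symm.adjoint_comp, zero_opTensor]
  have hvw : V.adjoint ∘L W ∘L W.adjoint = 0 := by
    rw [← ContinuousLinearMap.comp_assoc, h.symm.adjoint_comp, ContinuousLinearMap.zero_comp]
  have hv' : V.adjoint ∘L V ∘L V.adjoint = V.adjoint := by
    rw [← ContinuousLinearMap.comp_assoc, h.left]; rfl
  have hw' : W.adjoint ∘L W ∘L W.adjoint = W.adjoint := by
    rw [← ContinuousLinearMap.comp_assoc, h.right]; rfl
  have h1 : opTensor V.adjoint W.adjoint ∘L glue V W ρ₁ ρ₂ r =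
      (r : ℂ) • opTensor V.adjoint W.adjoint := by
    simp only [glue, corner, ContinuousLinearMap.comp_add, ContinuousLinearMap.comp_smul,
      ← opTensor_comp, hvw, hv', hw', zero_opTensor, smul_zero, add_zero]
    rw [← ContinuousLinearMap.comp_assoc _ (opTensor V V), hv,
      ← ContinuousLinearMap.comp_assoc _ (opTensor W W), hw,
      ContinuousLinearMap.zero_comp, ContinuousLinearMap.zero_comp, zero_add, zero_add]
  exact congrArg (fun f => f x) h1

/-- A vector is zero when its four blocks are zero. -/
theorem eq_zero (h : IsSplitting V W) {x : HTensor K K}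
    (h₁₁ : opTensor V.adjoint V.adjoint x = 0) (h₁₂ : opTensor V.adjoint W.adjoint x = 0)
    (h₂₁ : opTensor W.adjoint V.adjoint x = 0) (h₂₂ : opTensor W.adjoint W.adjoint x = 0) :
    x = 0 := by
  have h1 : (opTensor (1 : K →L[ℂ] K) (1 : K →L[ℂ] K)) x = x := by rw [opTensor_one]; rfl
  -- Expanding 1⊗1 with 1 = VV* + WW* on both legs rebuilds x from its four blocks.
  rw [← h1, ← h.add]
  simp [opTensor_add_left, opTensor_add_right, opTensor_comp, h₁₁, h₁₂, h₂₁, h₂₂]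

/-- The kernel of the glued operator has no mixed blocks. -/
theorem eq_zero_of_glue_eq_zero (h : IsSplitting V W) (hr : r ≠ 0) {x : HTensor K K}
    (hx : glue V W ρ₁ ρ₂ r x = 0)
    (k₁ : ρ₁ (opTensor V.adjoint V.adjoint x) = 0 → opTensor V.adjoint V.adjoint x = 0)
    (k₂ : ρ₂ (opTensor W.adjoint W.adjoint x) = 0 → opTensor W.adjoint W.adjoint x = 0) :
    x = 0 := by
  have hr' : (r : ℂ) ≠ 0 := by exact_mod_cast hr
  have hx' : glue W V ρ₂ ρ₁ r x = 0 := by rw [glue_comm, hx]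
  refine h.eq_zero (k₁ ?_) ?_ ?_ (k₂ ?_)
  · rw [← h.adjoint_opTensor_glue (ρ₁ := ρ₁) (ρ₂ := ρ₂) (r := r), hx, map_zero]
  · have := h.opTensor_glue (ρ₁ := ρ₁) (ρ₂ := ρ₂) (r := r) x
    rw [hx, map_zero] at this
    exact (smul_eq_zero.1 this.symm).resolve_left hr'
  · have := h.symm.opTensor_glue (ρ₁ := ρ₂) (ρ₂ := ρ₁) (r := r) x
    rw [hx', map_zero] at this
    exact (smul_eq_zero.1 this.symm).resolve_left hr'
  · rw [← h.symm.adjoint_opTensor_glue (ρ₁ := ρ₂) (ρ₂ := ρ₁) (r := r), hx', map_zero]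

/-- V⊗V is an isometry, so the inner factor (V⊗V)*(V⊗V) disappears. -/
theorem corner_mul (h : IsSplitting V W) (S T : HTensor H₁ H₁ →L[ℂ] HTensor H₁ H₁) :
    corner V (S * T) = corner V S * corner V T := by
  have := h.adjoint_opTensor_comp
  ext z
  have h1 : ∀ y, (opTensor V V).adjoint (opTensor V V y) = y := fun y =>
    congrArg (fun f => f y) this
  simp [corner, h1]

/-- The glued operator acts on a corner by the corresponding diagonal block. -/
theorem glue_mul_corner (h : IsSplitting V W) (T : HTensor H₁ H₁ →L[ℂ] HTensor H₁ H₁) :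
    glue V W ρ₁ ρ₂ r * corner V T = corner V (ρ₁ * T) := by
  have h1 : corner W ρ₂ * corner V T = 0 := by
    have hw : opTensor W.adjoint W.adjoint ∘L opTensor V V = 0 := by
      rw [← opTensor_comp, h.adjoint_comp, zero_opTensor]
    have h1 : ∀ y, opTensor W.adjoint W.adjoint (opTensor V V y) = 0 := fun y =>
      congrArg (fun f => f y) hw
    ext z
    simp [corner, adjoint_opTensor W, h1]
  have hvw : (W ∘L W.adjoint) ∘L V = 0 := by
    rw [ContinuousLinearMap.comp_assoc, h.adjoint_comp, ContinuousLinearMap.comp_zero]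
  have h2 : opTensor (V ∘L V.adjoint) (W ∘L W.adjoint) * corner V T = 0 := by
    rw [corner, ContinuousLinearMap.mul_def, ← ContinuousLinearMap.comp_assoc, ← opTensor_comp,
      hvw, opTensor_zero, ContinuousLinearMap.zero_comp]
  have h3 : opTensor (W ∘L W.adjoint) (V ∘L V.adjoint) * corner V T = 0 := by
    rw [corner, ContinuousLinearMap.mul_def, ← ContinuousLinearMap.comp_assoc, ← opTensor_comp,
      hvw, zero_opTensor, ContinuousLinearMap.zero_comp]
  rw [glue, add_mul, add_mul, add_mul, smul_mul_assoc, smul_mul_assoc, h1, h2, h3,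
    h.corner_mul]
  simp

end IsSplitting

end Glue

/-! ### Testing the diagonal on individual minimal projections. -/

section Diagonal

variable {A H : Type*} [CStarAlgebra A]
  [NormedAddCommGroup H] [InnerProductSpace ℂ H] [CompleteSpace H]

theorem opTensor_apply_mem_diagSubspace {π : A →⋆ₐ[ℂ] (H →L[ℂ] H)} {p : H →L[ℂ] H}
    (hp : IsMinimalProjection π p) (z : HTensor H H) : opTensor p p z ∈ diagSubspace π :=
  Submodule.le_topologicalClosure _ ((le_iSup₂ (f := fun (p : H →L[ℂ] H)
    (_ : IsMinimalProjection π p) => (opTensor p p).range) p hp) ⟨z, rfl⟩)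

/-- The kernel of T is a closed subspace, so it contains the closed span of the ranges of the p⊗p
once it contains each of them. This removes the supremum from the axiom ρP_δ = 0. -/
theorem mul_diagProj_eq_zero_iff {π : A →⋆ₐ[ℂ] (H →L[ℂ] H)}
    {T : HTensor H H →L[ℂ] HTensor H H} :
    T * diagProj π = 0 ↔ ∀ p, IsMinimalProjection π p → T * opTensor p p = 0 := by
  constructor
  · intro h p hp
    ext z
    have h1 : diagProj π (opTensor p p z) = opTensor p p z :=
      Submodule.starProjection_eq_self_iff.2 (opTensor_apply_mem_diagSubspace hp z)
    rw [mul_apply_eq_comp, ← h1, ← mul_apply_eq_comp, h]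
    rfl
  · intro h
    have hle : diagSubspace π ≤ T.ker := by
      refine Submodule.topologicalClosure_minimal _ (iSup₂_le fun p hp => ?_) T.isClosed_ker
      rintro _ ⟨z, rfl⟩
      exact congrArg (fun f => f z) (h p hp)
    ext z
    exact hle (Submodule.starProjection_apply_mem _ _)

/-- Each p⊗p is self-adjoint, so being orthogonal to its range means lying in its kernel; the
passage to the closed span is again by closedness of a kernel. -/
theorem mem_orthogonal_diagSubspace_iff {π : A →⋆ₐ[ℂ] (H →L[ℂ] H)} {x : HTensor H H} :
    x ∈ (diagSubspace π)ᗮ ↔ ∀ p, IsMinimalProjection π p → opTensor p p x = 0 := by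
  have hadj : ∀ p, IsMinimalProjection π p → (opTensor p p).adjoint = opTensor p p := by
    intro p hp
    have h := hp.isStarProjection.isSelfAdjoint
    rw [ContinuousLinearMap.isSelfAdjoint_iff'] at h
    rw [adjoint_opTensor, h]
  constructor
  · intro h p hp
    refine ext_inner_left ℂ fun z => ?_
    rw [inner_zero_right, ← hadj p hp, ContinuousLinearMap.adjoint_inner_right]
    exact (Submodule.mem_orthogonal _ _).1 h _ (opTensor_apply_mem_diagSubspace hp z)
  · intro h
    have hle : diagSubspace π ≤ (innerSL ℂ x).ker := by
      refine Submodule.topologicalClosure_minimal _ (iSup₂_le fun p hp => ?_)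
        (innerSL ℂ x).isClosed_ker
      rintro _ ⟨z, rfl⟩
      change inner ℂ x (opTensor p p z) = 0
      rw [← ContinuousLinearMap.adjoint_inner_left, hadj p hp, h p hp, inner_zero_left]
    exact (Submodule.mem_orthogonal' _ _).2 fun y hy => hle hy

end Diagonal

/-! ### Block diagonal operators and their commutants. -/

section OpSum

variable {H₁ H₂ : Type*}
  [NormedAddCommGroup H₁] [InnerProductSpace ℂ H₁] [CompleteSpace H₁]
  [NormedAddCommGroup H₂] [InnerProductSpace ℂ H₂] [CompleteSpace H₂]

theorem inl_apply (x : H₁) : inl H₁ H₂ x = WithLp.toLp 2 (x, 0) := rfl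

theorem inr_apply (x : H₂) : inr H₁ H₂ x = WithLp.toLp 2 (0, x) := rfl

theorem isSplitting_inl_inr : IsSplitting (inl H₁ H₂) (inr H₁ H₂) where
  left := by ext x; simp [adjoint_inl_apply, inl_apply]
  right := by ext x; simp [adjoint_inr_apply, inr_apply]
  add := by
    ext x
    apply WithLp.ofLp_injective
    simp [adjoint_inl_apply, adjoint_inr_apply, inl_apply, inr_apply]
    rfl

theorem opSum_zero_right (S : H₁ →L[ℂ] H₁) :
    opSum S (0 : H₂ →L[ℂ] H₂) = inl H₁ H₂ ∘L S ∘L (inl H₁ H₂).adjoint := by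
  ext x
  simp [opSum_apply, adjoint_inl_apply, inl_apply]

theorem opSum_zero_left (T : H₂ →L[ℂ] H₂) :
    opSum (0 : H₁ →L[ℂ] H₁) T = inr H₁ H₂ ∘L T ∘L (inr H₁ H₂).adjoint := by
  ext x
  simp [opSum_apply, adjoint_inr_apply, inr_apply]

theorem opSum_mul (S S' : H₁ →L[ℂ] H₁) (T T' : H₂ →L[ℂ] H₂) :
    opSum S T * opSum S' T' = opSum (S * S') (T * T') := rfl

theorem star_opSum (S : H₁ →L[ℂ] H₁) (T : H₂ →L[ℂ] H₂) :
    star (opSum S T) = opSum (star S) (star T) := by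
  symm
  rw [ContinuousLinearMap.star_eq_adjoint (opSum S T), ContinuousLinearMap.eq_adjoint_iff]
  intro x y
  simp [opSum_apply, ContinuousLinearMap.star_eq_adjoint, ContinuousLinearMap.adjoint_inner_left]

theorem opSum_inj {S S' : H₁ →L[ℂ] H₁} {T T' : H₂ →L[ℂ] H₂} :
    opSum S T = opSum S' T' ↔ S = S' ∧ T = T' := by
  refine ⟨fun h => ⟨?_, ?_⟩, fun h => by rw [h.1, h.2]⟩
  · ext x
    exact congrArg (fun f => (f (WithLp.toLp 2 (x, 0))).fst) h
  · ext x
    exact congrArg (fun f => (f (WithLp.toLp 2 (0, x))).snd) h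

theorem opSum_zero_zero : opSum (0 : H₁ →L[ℂ] H₁) (0 : H₂ →L[ℂ] H₂) = 0 := rfl

theorem isStarProjection_opSum {S : H₁ →L[ℂ] H₁} {T : H₂ →L[ℂ] H₂} :
    IsStarProjection (opSum S T) ↔ IsStarProjection S ∧ IsStarProjection T := by
  simp only [isStarProjection_iff', opSum_mul, star_opSum, opSum_inj]
  tauto

/-- The commutant of a set of block diagonal operators is computed blockwise. -/
theorem centralizer_image2_opSum {X₁ : Set (H₁ →L[ℂ] H₁)} {X₂ : Set (H₂ →L[ℂ] H₂)}
    (h₁₀ : 0 ∈ X₁) (h₁₁ : 1 ∈ X₁) (h₂₀ : 0 ∈ X₂) :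
    Set.centralizer (Set.image2 opSum X₁ X₂) =
      Set.image2 opSum (Set.centralizer X₁) (Set.centralizer X₂) := by
  apply Set.Subset.antisymm
  · intro T hT
    -- Commuting with the projection 1 ⊕ 0 forces T to be block diagonal. Commuting with a ⊕ 0 and 0
    -- ⊕ b then puts each block in the corresponding commutant.
    have hc : opSum (1 : H₁ →L[ℂ] H₁) (0 : H₂ →L[ℂ] H₂) * T = T * opSum 1 0 :=
      hT _ ⟨1, h₁₁, 0, h₂₀, rfl⟩
    let S₁ : H₁ →L[ℂ] H₁ := (inl H₁ H₂).adjoint ∘L T ∘L inl H₁ H₂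
    let S₂ : H₂ →L[ℂ] H₂ := (inr H₁ H₂).adjoint ∘L T ∘L inr H₁ H₂
    have e : T = opSum S₁ S₂ := by
      have hl : ∀ x, (T (inl H₁ H₂ x)).snd = 0 := fun x => by
        have := congrArg (fun f => (f (inl H₁ H₂ x)).snd) hc
        simpa [opSum_apply, inl_apply] using this.symm
      have hr : ∀ x, (T (inr H₁ H₂ x)).fst = 0 := fun x => by
        have h0 : opSum (1 : H₁ →L[ℂ] H₁) (0 : H₂ →L[ℂ] H₂) (inr H₁ H₂ x) = 0 := by
          apply WithLp.ofLp_injective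
          simp [opSum_apply, inr_apply]
        have := congrArg (fun f => (f (inr H₁ H₂ x)).fst) hc
        simpa [h0, opSum_apply] using this
      ext x
      have hx : x = inl H₁ H₂ x.fst + inr H₁ H₂ x.snd := by
        apply WithLp.ofLp_injective
        simp [inl_apply, inr_apply]
        rfl
      apply WithLp.ofLp_injective
      refine Prod.ext ?_ ?_
      · change (T x).fst = S₁ x.fst
        conv_lhs => rw [hx, map_add]
        simp [hr, S₁, adjoint_inl_apply]
      · change (T x).snd = S₂ x.snd
        conv_lhs => rw [hx, map_add]
        simp [hl, S₂, adjoint_inr_apply]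
    rw [e] at hT ⊢
    refine ⟨S₁, fun a ha => ?_, S₂, fun b hb => ?_, rfl⟩
    · have := hT _ ⟨a, ha, 0, h₂₀, rfl⟩
      rw [opSum_mul, opSum_mul, opSum_inj] at this
      exact this.1
    · have := hT _ ⟨0, h₁₀, b, hb, rfl⟩
      rw [opSum_mul, opSum_mul, opSum_inj] at this
      exact this.2
  · rintro _ ⟨S, hS, T, hT, rfl⟩ _ ⟨a, ha, b, hb, rfl⟩
    rw [opSum_mul, opSum_mul, hS a ha, hT b hb]

end OpSum

/-! ### Envelope and minimal projections of a direct sum; the diagonal axioms. -/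

section RepSum

variable {A₁ A₂ H₁ H₂ : Type*} [CStarAlgebra A₁] [CStarAlgebra A₂]
  [NormedAddCommGroup H₁] [InnerProductSpace ℂ H₁] [CompleteSpace H₁]
  [NormedAddCommGroup H₂] [InnerProductSpace ℂ H₂] [CompleteSpace H₂]
  {π₁ : A₁ →⋆ₐ[ℂ] (H₁ →L[ℂ] H₁)} {π₂ : A₂ →⋆ₐ[ℂ] (H₂ →L[ℂ] H₂)}

theorem repSum_apply (a : A₁ × A₂) : repSum π₁ π₂ a = opSum (π₁ a.1) (π₂ a.2) := rfl

/-- The blockwise commutant is taken twice: first for the ranges, which contain 0 and 1 as the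
representations are unital, then for the commutants, which always contain them. -/
theorem envelope_repSum :
    envelope (repSum π₁ π₂) = Set.image2 opSum (envelope π₁) (envelope π₂) := by
  have h : Set.range (repSum π₁ π₂) = Set.image2 opSum (Set.range π₁) (Set.range π₂) := by
    ext T
    constructor
    · rintro ⟨a, rfl⟩
      exact ⟨_, ⟨a.1, rfl⟩, _, ⟨a.2, rfl⟩, rfl⟩
    · rintro ⟨_, ⟨a, rfl⟩, _, ⟨b, rfl⟩, rfl⟩
      exact ⟨(a, b), rfl⟩
  rw [envelope, h, centralizer_image2_opSum (Set.mem_range.2 ⟨0, map_zero π₁⟩)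
      (Set.mem_range.2 ⟨1, map_one π₁⟩) (Set.mem_range.2 ⟨0, map_zero π₂⟩),
    centralizer_image2_opSum Set.zero_mem_centralizer Set.one_mem_centralizer
      Set.zero_mem_centralizer]
  rfl

theorem opSum_mem_envelope {S : H₁ →L[ℂ] H₁} {T : H₂ →L[ℂ] H₂} :
    opSum S T ∈ envelope (repSum π₁ π₂) ↔ S ∈ envelope π₁ ∧ T ∈ envelope π₂ := by
  rw [envelope_repSum]
  constructor
  · rintro ⟨S', hS, T', hT, h⟩
    obtain ⟨rfl, rfl⟩ := opSum_inj.1 h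
    exact ⟨hS, hT⟩
  · rintro ⟨hS, hT⟩
    exact ⟨S, hS, T, hT, rfl⟩

theorem zero_mem_envelope {A H : Type*} [CStarAlgebra A]
    [NormedAddCommGroup H] [InnerProductSpace ℂ H] [CompleteSpace H]
    (π : A →⋆ₐ[ℂ] (H →L[ℂ] H)) : 0 ∈ envelope π :=
  Set.zero_mem_centralizer

/-- Between projections the order is the algebraic relation pq = p, which is read off blockwise. -/
theorem opSum_le_opSum {S S' : H₁ →L[ℂ] H₁} {T T' : H₂ →L[ℂ] H₂}
    (hS : IsStarProjection S) (hS' : IsStarProjection S') (hT : IsStarProjection T)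
    (hT' : IsStarProjection T') : opSum S T ≤ opSum S' T' ↔ S ≤ S' ∧ T ≤ T' := by
  rw [(isStarProjection_opSum.2 ⟨hS, hT⟩).le_iff_mul_eq_left
    (isStarProjection_opSum.2 ⟨hS', hT'⟩), opSum_mul, opSum_inj, hS.le_iff_mul_eq_left hS',
    hT.le_iff_mul_eq_left hT']

theorem IsMinimalProjection.opSum_left {p : H₁ →L[ℂ] H₁} (hp : IsMinimalProjection π₁ p) :
    IsMinimalProjection (repSum π₁ π₂) (opSum p 0) where
  isStarProjection := isStarProjection_opSum.2 ⟨hp.isStarProjection, .zero _⟩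
  mem := opSum_mem_envelope.2 ⟨hp.mem, zero_mem_envelope π₂⟩
  ne_zero h := hp.ne_zero (opSum_inj.1 (h.trans opSum_zero_zero.symm)).1
  minimal q hq hqp hle := by
    rw [envelope_repSum] at hq
    obtain ⟨S, hS, T, hT, rfl⟩ := hq
    obtain ⟨hS', hT'⟩ := isStarProjection_opSum.1 hqp
    obtain ⟨h1, h2⟩ := (opSum_le_opSum hS' hp.isStarProjection hT' (.zero _)).1 hle
    obtain rfl : T = 0 := le_antisymm h2 hT'.nonneg
    rcases hp.minimal S hS hS' h1 with rfl | rfl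
    · exact Or.inl opSum_zero_zero
    · exact Or.inr rfl

theorem IsMinimalProjection.opSum_right {p : H₂ →L[ℂ] H₂} (hp : IsMinimalProjection π₂ p) :
    IsMinimalProjection (repSum π₁ π₂) (opSum 0 p) where
  isStarProjection := isStarProjection_opSum.2 ⟨.zero _, hp.isStarProjection⟩
  mem := opSum_mem_envelope.2 ⟨zero_mem_envelope π₁, hp.mem⟩
  ne_zero h := hp.ne_zero (opSum_inj.1 (h.trans opSum_zero_zero.symm)).2
  minimal q hq hqp hle := by
    rw [envelope_repSum] at hq
    obtain ⟨S, hS, T, hT, rfl⟩ := hq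
    obtain ⟨hS', hT'⟩ := isStarProjection_opSum.1 hqp
    obtain ⟨h1, h2⟩ := (opSum_le_opSum hS' (.zero _) hT' hp.isStarProjection).1 hle
    obtain rfl : S = 0 := le_antisymm h1 hS'.nonneg
    rcases hp.minimal T hT hT' h2 with rfl | rfl
    · exact Or.inl opSum_zero_zero
    · exact Or.inr rfl

/-- The minimal projections of the envelope of a direct sum live on one of the summands. -/
theorem IsMinimalProjection.eq_opSum {p : HSum H₁ H₂ →L[ℂ] HSum H₁ H₂}
    (hp : IsMinimalProjection (repSum π₁ π₂) p) :
    (∃ q, IsMinimalProjection π₁ q ∧ p = opSum q 0) ∨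
      ∃ q, IsMinimalProjection π₂ q ∧ p = opSum 0 q := by
  have hmem := hp.mem
  rw [envelope_repSum] at hmem
  obtain ⟨S, hS, T, hT, rfl⟩ := hmem
  obtain ⟨hS', hT'⟩ := isStarProjection_opSum.1 hp.isStarProjection
  -- S ⊕ 0 is a subprojection of p = S ⊕ T in the envelope, so by minimality either S = 0 or T = 0.
  rcases hp.minimal (opSum S 0) (opSum_mem_envelope.2 ⟨hS, zero_mem_envelope π₂⟩)
    (isStarProjection_opSum.2 ⟨hS', .zero _⟩)
    ((opSum_le_opSum hS' hS' (.zero _) hT').2 ⟨le_rfl, hT'.nonneg⟩) with h | h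
  · obtain rfl := (opSum_inj.1 (h.trans opSum_zero_zero.symm)).1
    refine Or.inr ⟨T, ⟨hT', hT, fun h => hp.ne_zero (by rw [h, opSum_zero_zero]),
      fun q hq hqp hle => ?_⟩, rfl⟩
    rcases hp.minimal (opSum 0 q) (opSum_mem_envelope.2 ⟨hS, hq⟩)
      (isStarProjection_opSum.2 ⟨hS', hqp⟩)
      ((opSum_le_opSum hS' hS' hqp hT').2 ⟨le_rfl, hle⟩) with h | h
    · exact Or.inl (opSum_inj.1 (h.trans opSum_zero_zero.symm)).2
    · exact Or.inr (opSum_inj.1 h).2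
  · obtain rfl := (opSum_inj.1 h).2
    refine Or.inl ⟨S, ⟨hS', hS, fun h => hp.ne_zero (by rw [h, opSum_zero_zero]),
      fun q hq hqp hle => ?_⟩, rfl⟩
    rcases hp.minimal (opSum q 0) (opSum_mem_envelope.2 ⟨hq, hT⟩)
      (isStarProjection_opSum.2 ⟨hqp, hT'⟩)
      ((opSum_le_opSum hqp hS' hT' hT').2 ⟨hle, le_rfl⟩) with h | h
    · exact Or.inl (opSum_inj.1 (h.trans opSum_zero_zero.symm)).1
    · exact Or.inr (opSum_inj.1 h).1

theorem corner_opTensor {H K : Type*} [NormedAddCommGroup H] [InnerProductSpace ℂ H]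
    [CompleteSpace H] [NormedAddCommGroup K] [InnerProductSpace ℂ K] [CompleteSpace K]
    (V : H →L[ℂ] K) (S T : H →L[ℂ] H) :
    corner V (opTensor S T) = opTensor (V ∘L S ∘L V.adjoint) (V ∘L T ∘L V.adjoint) := by
  rw [corner, adjoint_opTensor, opTensor_comp, opTensor_comp]

variable {ρ₁ : HTensor H₁ H₁ →L[ℂ] HTensor H₁ H₁} {ρ₂ : HTensor H₂ H₂ →L[ℂ] HTensor H₂ H₂} {r : ℝ}

theorem sumMetric_eq_glue :
    sumMetric π₁ π₂ ρ₁ ρ₂ r = glue (inl H₁ H₂) (inr H₁ H₂) ρ₁ ρ₂ r := by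
  have h1 : repSum π₁ π₂ (1, 0) = inl H₁ H₂ ∘L (inl H₁ H₂).adjoint := by
    rw [repSum_apply, map_zero, opSum_zero_right, map_one]; rfl
  have h2 : repSum π₁ π₂ (0, 1) = inr H₁ H₂ ∘L (inr H₁ H₂).adjoint := by
    rw [repSum_apply, map_zero, opSum_zero_left, map_one]; rfl
  rw [sumMetric, h1, h2, glue]

theorem sumMetric_mul_diagProj (h₁ : ρ₁ * diagProj π₁ = 0) (h₂ : ρ₂ * diagProj π₂ = 0) :
    sumMetric π₁ π₂ ρ₁ ρ₂ r * diagProj (repSum π₁ π₂) = 0 := by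
  rw [mul_diagProj_eq_zero_iff] at h₁ h₂ ⊢
  intro p hp
  rcases hp.eq_opSum with ⟨q, hq, rfl⟩ | ⟨q, hq, rfl⟩
  · rw [opSum_zero_right, ← corner_opTensor, sumMetric_eq_glue,
      isSplitting_inl_inr.glue_mul_corner, h₁ q hq]
    simp [corner]
  · rw [opSum_zero_left, ← corner_opTensor, sumMetric_eq_glue, glue_comm,
      isSplitting_inl_inr.symm.glue_mul_corner, h₂ q hq]
    simp [corner]

/-- The hypothesis says (V⊗V)(p⊗p)(V*⊗V*)x = 0, and the isometry V⊗V can be cancelled by its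
adjoint. -/
theorem IsSplitting.adjoint_mem_orthogonal {K : Type*} [NormedAddCommGroup K]
    [InnerProductSpace ℂ K] [CompleteSpace K] {V : H₁ →L[ℂ] K} {W : H₂ →L[ℂ] K}
    (h : IsSplitting V W) {x : HTensor K K}
    (hx : ∀ p, IsMinimalProjection π₁ p →
      opTensor (V ∘L p ∘L V.adjoint) (V ∘L p ∘L V.adjoint) x = 0) :
    opTensor V.adjoint V.adjoint x ∈ (diagSubspace π₁)ᗮ := by
  rw [mem_orthogonal_diagSubspace_iff]
  intro p hp
  have h1 := hx p hp
  rw [← corner_opTensor, corner, adjoint_opTensor] at h1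
  have h2 := congrArg (fun f => f (opTensor p p (opTensor V.adjoint V.adjoint x)))
    h.adjoint_opTensor_comp
  exact h2.symm.trans ((congrArg (opTensor V V).adjoint h1).trans (map_zero _))

theorem sumMetric_kernel
    (h₁ : ∀ x ∈ (diagSubspace π₁)ᗮ, ρ₁ x = 0 → x = 0)
    (h₂ : ∀ x ∈ (diagSubspace π₂)ᗮ, ρ₂ x = 0 → x = 0) (hr : r ≠ 0)
    {x : HTensor (HSum H₁ H₂) (HSum H₁ H₂)} (hx : x ∈ (diagSubspace (repSum π₁ π₂))ᗮ)
    (h0 : sumMetric π₁ π₂ ρ₁ ρ₂ r x = 0) : x = 0 := by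
  rw [sumMetric_eq_glue] at h0
  rw [mem_orthogonal_diagSubspace_iff] at hx
  refine isSplitting_inl_inr.eq_zero_of_glue_eq_zero hr h0 (h₁ _ ?_) (h₂ _ ?_)
  · refine isSplitting_inl_inr.adjoint_mem_orthogonal fun p hp => ?_
    rw [← opSum_zero_right]
    exact hx _ hp.opSum_left
  · refine isSplitting_inl_inr.symm.adjoint_mem_orthogonal fun p hp => ?_
    rw [← opSum_zero_left]
    exact hx _ hp.opSum_right

end RepSum

/-! ### Corners of the spatial tensor product. -/

section Membership

variable {A H₁ H₂ K : Type*} [CStarAlgebra A]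
  [NormedAddCommGroup H₁] [InnerProductSpace ℂ H₁] [CompleteSpace H₁]
  [NormedAddCommGroup H₂] [InnerProductSpace ℂ H₂] [CompleteSpace H₂]
  [NormedAddCommGroup K] [InnerProductSpace ℂ K] [CompleteSpace K]

/-- `corner V` is continuous, linear, multiplicative and *-preserving, so membership in a closed
*-subalgebra propagates from the generators. -/
theorem IsSplitting.corner_mem {V : H₁ →L[ℂ] K} {W : H₂ →L[ℂ] K} (h : IsSplitting V W)
    {π : A →⋆ₐ[ℂ] (H₁ →L[ℂ] H₁)} {S : StarSubalgebra ℂ (HTensor K K →L[ℂ] HTensor K K)}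
    (hS : IsClosed (S : Set (HTensor K K →L[ℂ] HTensor K K)))
    (hV : ∀ a b, corner V (opTensor (π a) (π b)) ∈ S)
    {T : HTensor H₁ H₁ →L[ℂ] HTensor H₁ H₁} (hT : T ∈ spatialTensor π π) : corner V T ∈ S := by
  have hcont : Continuous fun T : HTensor H₁ H₁ →L[ℂ] HTensor H₁ H₁ => corner V T :=
    continuous_const.clm_comp (continuous_id.clm_comp continuous_const)
  refine closure_minimal (t := (fun T => corner V T) ⁻¹' S) ?_ (hS.preimage hcont) hT
  intro T hT
  change corner V T ∈ S
  refine StarAlgebra.adjoin_induction (p := fun T _ => corner V T ∈ S) ?_ ?_ ?_ ?_ ?_ hT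
  · rintro _ ⟨a, b, rfl⟩
    exact hV a b
  · intro c
    -- `corner V` is not unital, so scalars need their own argument: 1 is the elementary tensor
    -- π(1)⊗π(1), to which `hV` applies.
    have h1 : corner V (algebraMap ℂ (HTensor H₁ H₁ →L[ℂ] HTensor H₁ H₁) c) =
        c • corner V (opTensor (π 1) (π 1)) := by
      rw [map_one, opTensor_one, Algebra.algebraMap_eq_smul_one]
      ext z
      simp [corner]
    rw [h1]
    exact S.smul_mem (hV 1 1) c
  · intro x y _ _ hx hy
    have h1 : corner V (x + y) = corner V x + corner V y := by
      ext z
      simp [corner]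
    rw [h1]
    exact add_mem hx hy
  · intro x y _ _ hx hy
    rw [h.corner_mul]
    exact mul_mem hx hy
  · intro x _ hx
    have h1 : corner V (star x) = star (corner V x) := by
      simp only [corner, ContinuousLinearMap.star_eq_adjoint, ContinuousLinearMap.adjoint_comp,
        ContinuousLinearMap.adjoint_adjoint]
      rfl
    rw [h1]
    exact star_mem hx

end Membership

/-! ### Transport of irreducible subspaces along an intertwining isometry. -/

section Atomic

variable {A B H K : Type*} [CStarAlgebra A] [CStarAlgebra B]
  [NormedAddCommGroup H] [InnerProductSpace ℂ H] [CompleteSpace H]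
  [NormedAddCommGroup K] [InnerProductSpace ℂ K] [CompleteSpace K]
  {π : A →⋆ₐ[ℂ] (H →L[ℂ] H)} {σ : B →⋆ₐ[ℂ] (K →L[ℂ] K)}

/-- An invariant subspace of the image pulls back along J to an invariant subspace of V, because
surjectivity of φ makes every π(a) the pullback of some σ(b). In the application φ is a coordinate
projection of A₁ × A₂. -/
theorem IsIrreducibleSub.map {V : Submodule ℂ H} (hV : IsIrreducibleSub π V) (J : H →ₗᵢ[ℂ] K)
    {φ : B → A} (hφ : Function.Surjective φ) (hJ : ∀ b x, σ b (J x) = J (π (φ b) x)) :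
    IsIrreducibleSub σ (V.map J.toLinearMap) where
  isClosed := J.isometry.isClosedEmbedding.isClosedMap _ hV.isClosed
  invariant := by
    rintro b _ ⟨x, hx, rfl⟩
    exact ⟨π (φ b) x, hV.invariant _ _ hx, (hJ b x).symm⟩
  ne_bot h := hV.ne_bot (Submodule.map_injective_of_injective (f := J.toLinearMap) J.injective
    (h.trans (Submodule.map_bot _).symm))
  irreducible W hW hinv hle := by
    have hW' : (W.comap J.toLinearMap).map J.toLinearMap = W := by
      rw [Submodule.map_comap_eq, inf_eq_right]
      exact hle.trans LinearMap.map_le_range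
    rw [← hW']
    rcases hV.irreducible (W.comap J.toLinearMap) (hW.preimage J.continuous) (fun a x hx => by
        obtain ⟨b, rfl⟩ := hφ a
        change J _ ∈ W
        rw [← hJ]
        exact hinv b _ hx) (fun x hx => by
        obtain ⟨y, hy, h⟩ := hle hx
        exact J.injective h ▸ hy) with h | h
    · exact Or.inl (by rw [h, Submodule.map_bot])
    · exact Or.inr (by rw [h])

/-- A linear isometry restricts to a unitary between a subspace and its image. -/
def submoduleMapIsometry (J : H →ₗᵢ[ℂ] K) (V : Submodule ℂ H) : V ≃ₗᵢ[ℂ] V.map J.toLinearMap where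
  toLinearEquiv := Submodule.equivMapOfInjective J.toLinearMap J.injective V
  norm_map' x := J.norm_map x

theorem coe_submoduleMapIsometry (J : H →ₗᵢ[ℂ] K) (V : Submodule ℂ H) (x : V) :
    (submoduleMapIsometry J V x : K) = J x := rfl

theorem EquivalentSub.of_map {V W : Submodule ℂ H} (J : H →ₗᵢ[ℂ] K)
    {φ : B → A} (hφ : Function.Surjective φ) (hJ : ∀ b x, σ b (J x) = J (π (φ b) x))
    (h : EquivalentSub σ (V.map J.toLinearMap) (W.map J.toLinearMap)) : EquivalentSub π V W := by
  obtain ⟨U, hU⟩ := h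
  refine ⟨(submoduleMapIsometry J V).trans (U.trans (submoduleMapIsometry J W).symm),
    fun a x y hxy => ?_⟩
  obtain ⟨b, rfl⟩ := hφ a
  have h1 := hU b (submoduleMapIsometry J V x) (submoduleMapIsometry J V y) (by
    rw [coe_submoduleMapIsometry, coe_submoduleMapIsometry, hJ, hxy])
  have h2 : ∀ u : W.map J.toLinearMap, J ((submoduleMapIsometry J W).symm u) = u := fun u => by
    rw [← coe_submoduleMapIsometry, LinearIsometryEquiv.apply_symm_apply]
  apply J.injective
  rw [← hJ]
  simp only [LinearIsometryEquiv.trans_apply, h2]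
  exact h1

/-- An intertwiner U would give Ux = U(π(a)x) = π(a)Ux = 0 for all x in V. -/
theorem not_equivalentSub {V W : Submodule ℂ H} (hV : V ≠ ⊥) (a : A) (h₁ : ∀ x ∈ V, π a x = x)
    (h₂ : ∀ x ∈ W, π a x = 0) : ¬ EquivalentSub π V W := by
  rintro ⟨U, hU⟩
  refine hV ((Submodule.eq_bot_iff _).2 fun x hx => ?_)
  have h := hU a ⟨x, hx⟩ ⟨x, hx⟩ (h₁ x hx).symm
  rw [h₂ _ (U ⟨x, hx⟩).2, Submodule.coe_eq_zero] at h
  exact congrArg Subtype.val ((map_eq_zero_iff U U.injective).1 h)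

end Atomic

/-! ### Atomicity, membership and faithfulness for the direct sum. -/

section AtomicSum

variable {A₁ A₂ H₁ H₂ : Type*} [CStarAlgebra A₁] [CStarAlgebra A₂]
  [NormedAddCommGroup H₁] [InnerProductSpace ℂ H₁] [CompleteSpace H₁]
  [NormedAddCommGroup H₂] [InnerProductSpace ℂ H₂] [CompleteSpace H₂]
  {π₁ : A₁ →⋆ₐ[ℂ] (H₁ →L[ℂ] H₁)} {π₂ : A₂ →⋆ₐ[ℂ] (H₂ →L[ℂ] H₂)}

/-- The inclusion of the first summand as a linear isometry. -/
def inlIsometry (H₁ H₂ : Type*) [NormedAddCommGroup H₁] [InnerProductSpace ℂ H₁]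
    [NormedAddCommGroup H₂] [InnerProductSpace ℂ H₂] : H₁ →ₗᵢ[ℂ] HSum H₁ H₂ where
  toLinearMap := (inl H₁ H₂).toLinearMap
  norm_map' x := by simp [inl]

/-- The inclusion of the second summand as a linear isometry. -/
def inrIsometry (H₁ H₂ : Type*) [NormedAddCommGroup H₁] [InnerProductSpace ℂ H₁]
    [NormedAddCommGroup H₂] [InnerProductSpace ℂ H₂] : H₂ →ₗᵢ[ℂ] HSum H₁ H₂ where
  toLinearMap := (inr H₁ H₂).toLinearMap
  norm_map' x := by simp [inr]

theorem inlIsometry_apply (x : H₁) : inlIsometry H₁ H₂ x = WithLp.toLp 2 (x, 0) := rfl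

theorem inrIsometry_apply (x : H₂) : inrIsometry H₁ H₂ x = WithLp.toLp 2 (0, x) := rfl

theorem inner_inlIsometry_inrIsometry (x : H₁) (y : H₂) :
    inner ℂ (inlIsometry H₁ H₂ x) (inrIsometry H₁ H₂ y) = 0 := by
  simp [inlIsometry_apply, inrIsometry_apply]

theorem repSum_inlIsometry (a : A₁ × A₂) (x : H₁) :
    repSum π₁ π₂ a (inlIsometry H₁ H₂ x) = inlIsometry H₁ H₂ (π₁ a.1 x) := by
  simp [repSum_apply, opSum_apply, inlIsometry_apply]

theorem repSum_inrIsometry (a : A₁ × A₂) (x : H₂) :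
    repSum π₁ π₂ a (inrIsometry H₁ H₂ x) = inrIsometry H₁ H₂ (π₂ a.2 x) := by
  simp [repSum_apply, opSum_apply, inrIsometry_apply]

/-- The canonical isometry from the ℓ² sum has range the closed span of the V i, and for a Hilbert
sum it is onto. -/
theorem topologicalClosure_iSup_eq_top {ι H : Type*} [NormedAddCommGroup H]
    [InnerProductSpace ℂ H] [CompleteSpace H] {V : ι → Submodule ℂ H}
    (hc : ∀ i, IsClosed (V i : Set H))
    (hV : IsHilbertSum ℂ (fun i => V i) (fun i => (V i).subtypeₗᵢ)) :
    (⨆ i, V i).topologicalClosure = ⊤ := by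
  have : ∀ i, CompleteSpace (V i) := fun i => (hc i).completeSpace_coe
  have h1 := hV.OrthogonalFamily.range_linearIsometry
  rw [LinearMap.range_eq_top.2 hV.surjective_isometry] at h1
  simpa using h1.symm

theorem map_mem_topologicalClosure {ι H K : Type*} [NormedAddCommGroup H] [InnerProductSpace ℂ H]
    [NormedAddCommGroup K] [InnerProductSpace ℂ K] {V : ι → Submodule ℂ H}
    (hV : (⨆ i, V i).topologicalClosure = ⊤) (J : H →ₗᵢ[ℂ] K) {S : Submodule ℂ K}
    (hS : ∀ i, (V i).map J.toLinearMap ≤ S) (x : H) : J x ∈ S.topologicalClosure := by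
  have h1 : (⨆ i, V i).topologicalClosure ≤ S.topologicalClosure.comap J.toLinearMap := by
    refine Submodule.topologicalClosure_minimal _ (iSup_le fun i => ?_)
      (S.isClosed_topologicalClosure.preimage J.continuous)
    exact Submodule.map_le_iff_le_comap.1 ((hS i).trans S.le_topologicalClosure)
  rw [hV] at h1
  exact h1 trivial

theorem IsAtomic.repSum (h₁ : IsAtomic π₁) (h₂ : IsAtomic π₂) : IsAtomic (repSum π₁ π₂) := by
  obtain ⟨ι₁, V₁, hs₁, hi₁, hn₁⟩ := h₁
  obtain ⟨ι₂, V₂, hs₂, hi₂, hn₂⟩ := h₂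
  have hfst : Function.Surjective (Prod.fst : A₁ × A₂ → A₁) := Prod.fst_surjective
  have hsnd : Function.Surjective (Prod.snd : A₁ × A₂ → A₂) := Prod.snd_surjective
  let V : ι₁ ⊕ ι₂ → Submodule ℂ (HSum H₁ H₂) :=
    Sum.elim (fun i => (V₁ i).map (inlIsometry H₁ H₂).toLinearMap)
      (fun i => (V₂ i).map (inrIsometry H₁ H₂).toLinearMap)
  have hirr : ∀ i, IsIrreducibleSub (QuantumMetric.repSum π₁ π₂) (V i) := by
    rintro (i | i)
    · exact (hi₁ i).map _ hfst repSum_inlIsometry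
    · exact (hi₂ i).map _ hsnd repSum_inrIsometry
  have : ∀ i, CompleteSpace (V i) := fun i => (hirr i).isClosed.completeSpace_coe
  refine ⟨ι₁ ⊕ ι₂, V, IsHilbertSum.mkInternal _ ?_ ?_, hirr, ?_⟩
  · rintro (i | i) (j | j) hij ⟨_, x, hx, rfl⟩ ⟨_, y, hy, rfl⟩
    · exact ((inlIsometry H₁ H₂).inner_map_map x y).trans
        (hs₁.OrthogonalFamily (fun h => hij (congrArg _ h)) ⟨x, hx⟩ ⟨y, hy⟩)
    · exact inner_inlIsometry_inrIsometry x y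
    · exact inner_eq_zero_symm.1 (inner_inlIsometry_inrIsometry y x)
    · exact ((inrIsometry H₁ H₂).inner_map_map x y).trans
        (hs₂.OrthogonalFamily (fun h => hij (congrArg _ h)) ⟨x, hx⟩ ⟨y, hy⟩)
  · rintro z -
    have hz : z = inlIsometry H₁ H₂ z.fst + inrIsometry H₁ H₂ z.snd := by
      apply WithLp.ofLp_injective
      simp [inlIsometry_apply, inrIsometry_apply]
      rfl
    rw [hz]
    exact add_mem
      (map_mem_topologicalClosure
        (topologicalClosure_iSup_eq_top (fun i => (hi₁ i).isClosed) hs₁) _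
        (fun i => le_iSup V (Sum.inl i)) _)
      (map_mem_topologicalClosure
        (topologicalClosure_iSup_eq_top (fun i => (hi₂ i).isClosed) hs₂) _
        (fun i => le_iSup V (Sum.inr i)) _)
  · rintro (i | i) (j | j) hij
    · exact fun h => hn₁ (fun h => hij (congrArg _ h)) (h.of_map _ hfst repSum_inlIsometry)
    -- The central projection (1, 0) acts as the identity on subspaces of H₁ and as zero on those of
    -- H₂; (0, 1) serves for the opposite order.
    · refine not_equivalentSub (hirr _).ne_bot (1, 0) ?_ ?_
      · rintro _ ⟨x, hx, rfl⟩
        exact (repSum_inlIsometry _ x).trans (by simp)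
      · rintro _ ⟨x, hx, rfl⟩
        exact (repSum_inrIsometry _ x).trans (by simp)
    · refine not_equivalentSub (hirr _).ne_bot (0, 1) ?_ ?_
      · rintro _ ⟨x, hx, rfl⟩
        exact (repSum_inrIsometry _ x).trans (by simp)
      · rintro _ ⟨x, hx, rfl⟩
        exact (repSum_inlIsometry _ x).trans (by simp)
    · exact fun h => hn₂ (fun h => hij (congrArg _ h)) (h.of_map _ hsnd repSum_inrIsometry)

theorem sumMetric_mem_spatialTensor {ρ₁ : HTensor H₁ H₁ →L[ℂ] HTensor H₁ H₁}
    {ρ₂ : HTensor H₂ H₂ →L[ℂ] HTensor H₂ H₂} (h₁ : ρ₁ ∈ spatialTensor π₁ π₁)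
    (h₂ : ρ₂ ∈ spatialTensor π₂ π₂) (r : ℝ) :
    sumMetric π₁ π₂ ρ₁ ρ₂ r ∈ spatialTensor (repSum π₁ π₂) (repSum π₁ π₂) := by
  have hgen : ∀ a b, opTensor (repSum π₁ π₂ a) (repSum π₁ π₂ b) ∈
      spatialTensor (repSum π₁ π₂) (repSum π₁ π₂) := fun a b =>
    StarSubalgebra.le_topologicalClosure _ (StarAlgebra.subset_adjoin ℂ _ ⟨a, b, rfl⟩)
  have hcl := StarSubalgebra.isClosed_topologicalClosure
    (StarAlgebra.adjoin ℂ {T | ∃ a b, T = opTensor (repSum π₁ π₂ a) (repSum π₁ π₂ b)})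
  refine add_mem (add_mem (add_mem ?_ ?_) ?_) ?_
  · exact isSplitting_inl_inr.corner_mem hcl
      (fun a b => (corner_inl_opTensor π₁ π₂ a b).symm ▸ hgen _ _) h₁
  · exact isSplitting_inl_inr.symm.corner_mem hcl
      (fun a b => (corner_inr_opTensor π₁ π₂ a b).symm ▸ hgen _ _) h₂
  · exact StarSubalgebra.smul_mem _ (hgen _ _) _
  · exact StarSubalgebra.smul_mem _ (hgen _ _) _

theorem repSum_injective (h₁ : Function.Injective π₁) (h₂ : Function.Injective π₂) :
    Function.Injective (repSum π₁ π₂) := fun a b h => by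
  obtain ⟨ha, hb⟩ := opSum_inj.1 h
  exact Prod.ext (h₁ ha) (h₂ hb)

end AtomicSum

end QuantumMetric

end

theorem theorem3 {A₁ A₂ H₁ H₂ : Type*} [CStarAlgebra A₁] [CStarAlgebra A₂]
    [NormedAddCommGroup H₁] [InnerProductSpace ℂ H₁] [CompleteSpace H₁]
    [NormedAddCommGroup H₂] [InnerProductSpace ℂ H₂] [CompleteSpace H₂]
    (π₁ : A₁ →⋆ₐ[ℂ] (H₁ →L[ℂ] H₁)) (π₂ : A₂ →⋆ₐ[ℂ] (H₂ →L[ℂ] H₂))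
    (ρ₁ : QuantumMetric.HTensor H₁ H₁ →L[ℂ] QuantumMetric.HTensor H₁ H₁)
    (ρ₂ : QuantumMetric.HTensor H₂ H₂ →L[ℂ] QuantumMetric.HTensor H₂ H₂)
    (h₁ : QuantumMetric.IsCompactQuantumMetricSpace A₁ ρ₁ π₁)
    (h₂ : QuantumMetric.IsCompactQuantumMetricSpace A₂ ρ₂ π₂)
    (r : ℝ) (hr : 2⁻¹ * max ‖ρ₁‖ ‖ρ₂‖ ≤ r) (hr₀ : 0 < r) :
    QuantumMetric.IsCompactQuantumMetricSpace (A₁ × A₂)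
      (QuantumMetric.sumMetric π₁ π₂ ρ₁ ρ₂ r) (QuantumMetric.repSum π₁ π₂) := by
  obtain ⟨f₁, a₁, m₁⟩ := h₁
  obtain ⟨f₂, a₂, m₂⟩ := h₂
  have hr₁ : ‖ρ₁‖ ≤ 2 * r := by linarith [le_max_left ‖ρ₁‖ ‖ρ₂‖]
  have hr₂ : ‖ρ₂‖ ≤ 2 * r := by linarith [le_max_right ‖ρ₁‖ ‖ρ₂‖]
  have hnonneg : 0 ≤ QuantumMetric.sumMetric π₁ π₂ ρ₁ ρ₂ r := by
    rw [QuantumMetric.sumMetric_eq_glue]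
    exact QuantumMetric.glue_nonneg m₁.nonneg m₂.nonneg hr₀.le
  have hmul := QuantumMetric.sumMetric_mul_diagProj (r := r) m₁.mul_diag m₂.mul_diag
  refine ⟨QuantumMetric.repSum_injective f₁ f₂, a₁.repSum a₂,
    QuantumMetric.sumMetric_mem_spatialTensor m₁.mem m₂.mem r, hnonneg, hmul, ?_,
    fun x hx h0 => QuantumMetric.sumMetric_kernel m₁.eq_zero_of_apply_eq_zero
      m₂.eq_zero_of_apply_eq_zero hr₀.ne' hx h0, ?_, ?_⟩
  -- Both factors are self-adjoint, so P_δρ = (ρP_δ)* = 0.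
  · have h := congrArg star hmul
    rwa [star_mul, star_zero, (IsSelfAdjoint.of_nonneg hnonneg).star_eq,
      (QuantumMetric.diagProj_isLeast _).1.1.isSelfAdjoint.star_eq] at h
  · rw [QuantumMetric.sumMetric_eq_glue]
    exact QuantumMetric.flip_glue m₁.flip_eq m₂.flip_eq
  · rw [QuantumMetric.sumMetric_eq_glue]
    exact QuantumMetric.midOne_glue_le QuantumMetric.isSplitting_inl_inr m₁.nonneg m₂.nonneg
      m₁.triangle m₂.triangle hr₁ hr₂
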